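/- Work in the Euclidean plane. A Steiner minimal tree of a finite point set $V$ is a shortest finite network of straight edges interconnecting all points of $V$; auxiliary vertices not in $V$ are allowed. The closed region enclosed by a closed polygonal curve is the union of the curve and the bounded components of its complement. In a polygonal chain, a right turn is a clockwise turn, and the angle at an inner vertex is the angle between the two segments meeting there. (i) Let $A_0,A_1,\dots,A_n$ be a Steiner spiral chain: consecutive points $A_{i-1},A_i$ are joined by edges of a Steiner minimal tree of some finite set $V$, and at every inner vertex $A_i$ ($1\le i\le n-1$) the chain turns right with $\angle A_{i-1}A_iA_{i+1}=120^\circ$ (for instance, $A_1,\dots,A_{n-1}$ are Steiner points and $A_n\in V$). Put $a_i=|A_{i-1}A_i|$. Let $0\le u<s\le v<\min(6,n)$, and let $H$ be the foot of the perpendicular from $A_u$ to the line $A_vA_{v+1}$. If $H$ lies on the closed ray from $A_v$ through $A_{v+1}$ and $|A_uH|<a_s$, then $A_n$ lies in the closed region enclosed by the polygon $A_uA_{u+1}\cdots A_vHA_u$. (ii) Let $n\ge 7$ and let $X_1X_2\cdots X_n$ be a simple polygonal chain that turns right with an angle of $120^\circ$ at each inner vertex. If the ray from $X_6$ through $X_7$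 meets one of the segments $X_1X_2,\ X_2X_3,\ X_3X_4,\ X_4X_5$, then all of $X_7,X_8,\dots,X_n$ lie in the closed region enclosed by the closed polygon $X_1X_2X_3X_4X_5X_6X_1$. -/

import Mathlib

open scoped EuclideanGeometry

noncomputable section

/-! The Euclidean plane is `ℂ`. -/

/-- The Euclidean length of the edge joining two points of the plane. -/
def edgeLength : Sym2 ℂ → ℝ :=
  Sym2.lift ⟨fun x y => dist x y, fun x y => dist_comm x y⟩

/-- A finite network of straight edges in the plane is a finite set of unordered pairs of points;
this is its total length. -/
def networkLength (E : Finset (Sym2 ℂ)) : ℝ := ∑ e ∈ E, edgeLength e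

/-- The graph of a network. -/
def networkGraph (E : Finset (Sym2 ℂ)) : SimpleGraph ℂ :=
  SimpleGraph.fromEdgeSet (E : Set (Sym2 ℂ))

/-- The network `E` interconnects the points of `V`, possibly through auxiliary vertices. -/
def Interconnects (V : Finset ℂ) (E : Finset (Sym2 ℂ)) : Prop :=
  ∀ x ∈ V, ∀ y ∈ V, (networkGraph E).Reachable x y

/-- `E` is a Steiner minimal tree of `V`: a shortest network interconnecting `V`. (Since all edges
of the graph have positive length, minimality forces it to be a tree.) -/
def IsSteinerMinimalTree (V : Finset ℂ) (E : Finset (Sym2 ℂ)) : Prop :=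
  Interconnects V E ∧
    ∀ E' : Finset (Sym2 ℂ), Interconnects V E' → networkLength E ≤ networkLength E'

/-- Going from `P` over `Q` to `R` one turns right (clockwise) at `Q`: the cross product of
`Q - P` and `R - Q` is negative. -/
def IsRightTurn (P Q R : ℂ) : Prop :=
  ((starRingEnd ℂ) (Q - P) * (R - Q)).im < 0

/-- At each inner vertex of the polygonal chain `A a, A (a + 1), …, A b` the angle is `120°` and the
turn is a right turn. -/
def IsRightTurning120 (A : ℕ → ℂ) (a b : ℕ) : Prop :=
  ∀ i, a ≤ i → i + 2 ≤ b →
    ∠ (A i) (A (i + 1)) (A (i + 2)) = 2 * Real.pi / 3 ∧ IsRightTurn (A i) (A (i + 1)) (A (i + 2))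

/-- `A 0, …, A n` is a Steiner spiral chain in the Steiner minimal tree `E` of `V`: consecutive
vertices are joined by edges of the tree, and at each inner vertex one turns right with angle
`120°`. (Nothing is required about which of the vertices are regular points, so this contains the
case where `A n ∈ V` and `A 1, …, A (n - 1)` are Steiner points.) -/
structure IsSteinerSpiralChain (V : Finset ℂ) (E : Finset (Sym2 ℂ)) (n : ℕ) (A : ℕ → ℂ) :
    Prop where
  minimal : IsSteinerMinimalTree V E
  adj : ∀ i < n, (networkGraph E).Adj (A i) (A (i + 1))
  turn : IsRightTurning120 A 0 n

/-- The closed ray that starts at `X` and passes through `Y`. -/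
def closedRay (X Y : ℂ) : Set ℂ := {z | ∃ t : ℝ, 0 ≤ t ∧ z = AffineMap.lineMap X Y t}

/-- The union of the segments of the polygonal chain `A a, A (a + 1), …, A b`. -/
def chainCurve (A : ℕ → ℂ) (a b : ℕ) : Set ℂ :=
  ⋃ i ∈ Finset.Ico a b, segment ℝ (A i) (A (i + 1))

/-- The closed region enclosed by a curve `Γ`: the curve together with the bounded connected
components of its complement. -/
def enclosedRegion (Γ : Set ℂ) : Set ℂ :=
  Γ ∪ {z | z ∉ Γ ∧ Bornology.IsBounded (connectedComponentIn Γᶜ z)}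

/-- The polygonal chain `A a, …, A b` is simple: its segments are nondegenerate, and two different
segments are disjoint, unless they are consecutive, when they share only their common vertex. -/
def IsSimpleChain (A : ℕ → ℂ) (a b : ℕ) : Prop :=
  (∀ i, a ≤ i → i < b → A i ≠ A (i + 1)) ∧
    ∀ i j, a ≤ i → i < j → j < b →
      ∀ z ∈ segment ℝ (A i) (A (i + 1)), z ∈ segment ℝ (A j) (A (j + 1)) → j = i + 1 ∧ z = A j

end

/-! The core is a trapping argument. A simple chain that keeps turning right by 60° spirals inwards.
Suppose it has entered a closed region `R` whose frontier consists of edges already drawn, of a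
barrier that later edges avoid, and of part of the prolongation of the current edge. The next edge
turns into `R`. It cannot meet the old edges, by simplicity, nor the barrier, nor the prolongation,
because it leaves the line of the current edge at once. So it stays inside, and cutting `R` down to
the right half-plane of the new edge restores the situation (`IsTrap.step`, `IsTrap.mem_of_le`).

In part (i) the minimality of the tree supplies what the trap needs, through exchanges of edges. If
two nonconsecutive edges met, splitting one of them at the meeting point would make part of the
other superfluous, so the chain is simple (`IsSteinerSpiralChain.isSimpleChain_of_le`). If an edge
from `A v` on touched the segment from `A u` to `H`, that segment could replace the edge of length
`a_s`, so `|A_u H| < a_s` makes the segment a barrier (`IsSteinerSpiralChain.le_dist_of_touch`). The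
region to trap the chain in is the one cut out by the edges from `A u` on and the perpendicular.

All edges have one of six directions. In the affine frame `hexX`, `hexY` the edges lie on lines
where `X`, `Y` or `X + Y` is constant, so the regions are given by linear inequalities. There are
five cases `m = v - u`; `m = 4` and `m = 5` split according to the side on which the last ray passes
the starting point.

When the ray of the sixth edge passes the starting point on the right, simplicity alone confines the
chain to the right of its first six edges (`IsHexChain.right_of_inward`). This settles one half of
`m = 5`. It also settles part (ii): meeting one of the first four edges forces the ray to pass on
that side, and the confining region lies in the polygon closed by the chord.

A bounded closed set whose frontier lies on a curve lies in the closed region enclosed by the curve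
(`subset_enclosedRegion`). Hence the curves need not be simple and the Jordan curve theorem is not
needed. -/

/-! ### Closed regions and frontiers -/

/-- A connected set that misses the frontier of a closed set `R` and meets `R` lies in the interior
of `R`. -/
theorem IsPreconnected.subset_interior_of_disjoint_frontier {S R : Set ℂ} (hS : IsPreconnected S)
    (hR : IsClosed R) (hf : ∀ z ∈ S, z ∉ frontier R) (hne : (S ∩ R).Nonempty) :
    S ⊆ interior R := by
  obtain ⟨z, hzS, hzR⟩ := hne
  have key := isPreconnected_iff_subset_of_disjoint.mp hS (interior R) Rᶜ isOpen_interior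
    hR.isOpen_compl
    (fun y hy => by
      by_cases h : y ∈ R
      · left
        by_contra h'
        exact hf y hy (hR.frontier_eq ▸ ⟨h, h'⟩)
      · exact Or.inr h)
    (by
      rw [Set.eq_empty_iff_forall_notMem]
      exact fun y hy => hy.2.2 (interior_subset hy.2.1))
  rcases key with h | h
  · exact h
  · exact absurd hzR (h hzS)

/-- A bounded closed set whose frontier lies on a curve is contained in the closed region enclosed
by the curve. -/
theorem subset_enclosedRegion {K Γ : Set ℂ} (hb : Bornology.IsBounded K)
    (hK : IsClosed K) (hf : frontier K ⊆ Γ) : K ⊆ enclosedRegion Γ := by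
  intro z hz
  by_cases hzΓ : z ∈ Γ
  · exact Or.inl hzΓ
  have hsub : connectedComponentIn Γᶜ z ⊆ interior K :=
    isPreconnected_connectedComponentIn.subset_interior_of_disjoint_frontier hK
      (fun w hw hwf => connectedComponentIn_subset _ _ hw (hf hwf))
      ⟨z, mem_connectedComponentIn hzΓ, hz⟩
  exact Or.inr ⟨hzΓ, hb.subset (hsub.trans interior_subset)⟩

theorem mem_of_mem_frontier {K U : Set ℂ} (hK : IsClosed K) (hU : IsOpen U) (hUK : U ⊆ K) {z : ℂ}
    (hz : z ∈ frontier K) : z ∈ K ∧ z ∉ U := by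
  rw [hK.frontier_eq] at hz
  exact ⟨hz.1, fun h => hz.2 (interior_maximal hUK hU h)⟩

/-! ### Right-turning chains with angles of 120° -/

/-- The rotation by `60°` clockwise. -/
noncomputable def hexRot : ℂ := ⟨1 / 2, -(√3 / 2)⟩

theorem sqrt_three_mul_self : √3 * √3 = 3 := Real.mul_self_sqrt (by norm_num)

theorem sqrt_three_pos : 0 < √3 := Real.sqrt_pos.mpr (by norm_num)

theorem hexRot_sq : hexRot ^ 2 = hexRot - 1 := by
  apply Complex.ext
  · simp [hexRot, pow_two]; nlinarith [sqrt_three_mul_self]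
  · simp [hexRot, pow_two]; ring

theorem hexRot_pow_three : hexRot ^ 3 = -1 := by
  linear_combination (hexRot + 1) * hexRot_sq

theorem hexRot_pow_four : hexRot ^ 4 = -hexRot := by
  linear_combination hexRot * hexRot_pow_three

theorem hexRot_pow_five : hexRot ^ 5 = 1 - hexRot := by
  linear_combination hexRot ^ 2 * hexRot_pow_three - hexRot_sq

theorem hexRot_ne_zero : hexRot ≠ 0 := by
  intro h
  have := congrArg Complex.re h
  norm_num [hexRot] at this

/-- The chain `B 0, …, B N` whose `k`-th edge is `ℓ k > 0` times the `k`-fold clockwise rotation of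
`d` by `60°`. -/
structure IsHexChain (B : ℕ → ℂ) (d : ℂ) (ℓ : ℕ → ℝ) (N : ℕ) : Prop where
  ne_zero : d ≠ 0
  pos : ∀ k < N, 0 < ℓ k
  step : ∀ k < N, B (k + 1) = B k + ℓ k * (d * hexRot ^ k)

/-- The edge after a right turn with angle `120°` is a positive multiple of the rotated edge. -/
theorem exists_pos_mul_hexRot {P Q R : ℂ} (hang : ∠ P Q R = 2 * Real.pi / 3)
    (hturn : IsRightTurn P Q R) : ∃ r : ℝ, 0 < r ∧ R - Q = r * (hexRot * (Q - P)) := by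
  have hw : Q - P ≠ 0 := by
    intro h
    simp [IsRightTurn, h] at hturn
  have hw' : R - Q ≠ 0 := by
    intro h
    simp [IsRightTurn, h] at hturn
  have hnw : 0 < ‖Q - P‖ := norm_pos_iff.mpr hw
  have hnw' : 0 < ‖R - Q‖ := norm_pos_iff.mpr hw'
  have hcos : inner ℝ (P - Q) (R - Q) = -(1 / 2) * (‖Q - P‖ * ‖R - Q‖) := by
    have h1 : InnerProductGeometry.angle (P - Q) (R - Q) = 2 * Real.pi / 3 := hang
    have h2 := InnerProductGeometry.cos_angle_mul_norm_mul_norm (P - Q) (R - Q)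
    have h3 : Real.cos (2 * Real.pi / 3) = -(1 / 2) := by
      rw [show 2 * Real.pi / 3 = Real.pi - Real.pi / 3 by ring, Real.cos_pi_sub,
        Real.cos_pi_div_three]
    rw [h1, h3, norm_sub_rev P Q] at h2
    exact h2.symm
  set w := Q - P with hwdef
  set w' := R - Q with hwdef'
  -- The argument of `c` is the turning angle from `w` to `w'`. It has to be shown to be `-60°`, the
  -- argument of `hexRot`.
  set c := (starRingEnd ℂ) w * w' with hc
  have hre : c.re = ‖w‖ * ‖w'‖ / 2 := by
    have : inner ℝ (P - Q) w' = -c.re := by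
      rw [← neg_sub Q P, ← hwdef, inner_neg_left, Complex.inner, hc, mul_comm]
    linarith [hcos, this]
  have him : c.im < 0 := hturn
  have hnorm : c.re * c.re + c.im * c.im = (‖w‖ * ‖w'‖) ^ 2 := by
    rw [← Complex.normSq_apply, ← Complex.sq_norm, hc, norm_mul, Complex.norm_conj]
  -- The modulus and the real part determine the imaginary part up to sign; the right turn selects
  -- the negative one.
  have him' : c.im = -(√3 / 2) * (‖w‖ * ‖w'‖) := by
    have hpos : 0 < √3 / 2 * (‖w‖ * ‖w'‖) := by
      have := sqrt_three_pos
      positivity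
    have h4 : (c.im - √3 / 2 * (‖w‖ * ‖w'‖)) * (c.im + √3 / 2 * (‖w‖ * ‖w'‖)) = 0 := by
      rw [hre] at hnorm
      linear_combination hnorm - (‖w‖ * ‖w'‖) ^ 2 / 4 * sqrt_three_mul_self
    rcases mul_eq_zero.mp h4 with h | h <;> linarith
  have hcval : c = ((‖w‖ * ‖w'‖ : ℝ) : ℂ) * hexRot := by
    apply Complex.ext
    · rw [Complex.re_ofReal_mul, hre]; simp [hexRot]; ring
    · rw [Complex.im_ofReal_mul, him']; simp [hexRot]; ring
  refine ⟨‖w'‖ / ‖w‖, div_pos hnw' hnw, ?_⟩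
  have hconj : (starRingEnd ℂ) w ≠ 0 := by simpa using hw
  apply mul_left_cancel₀ hconj
  have hn : (starRingEnd ℂ) w * w = ((‖w‖ : ℝ) : ℂ) ^ 2 := Complex.conj_mul' w
  have hne : ((‖w‖ : ℝ) : ℂ) ≠ 0 := by exact_mod_cast hnw.ne'
  calc (starRingEnd ℂ) w * w' = ((‖w‖ * ‖w'‖ : ℝ) : ℂ) * hexRot := hcval
    _ = ((‖w'‖ / ‖w‖ : ℝ) : ℂ) * hexRot * ((starRingEnd ℂ) w * w) := by
        rw [hn]; push_cast; field_simp
    _ = _ := by ring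

/-- The direction `d` is the first edge itself, so the `ℓ k` measure lengths in units of that edge.
The hypothesis `h0` is needed for a chain without inner vertices, where the turning condition is
void. -/
theorem IsRightTurning120.exists_isHexChain {B : ℕ → ℂ} {N : ℕ} (h : IsRightTurning120 B 0 N)
    (h0 : B 0 ≠ B 1) : ∃ d ℓ, IsHexChain B d ℓ N := by
  have key : ∀ k < N, ∃ r : ℝ, 0 < r ∧ B (k + 1) = B k + r * ((B 1 - B 0) * hexRot ^ k) := by
    intro k
    induction k with
    | zero => exact fun _ => ⟨1, one_pos, by simp⟩
    | succ k ih =>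
      intro hk
      obtain ⟨r, hr, hrk⟩ := ih (by omega)
      obtain ⟨hang, hturn⟩ := h k (Nat.zero_le k) (by omega)
      obtain ⟨q, hq, hqk⟩ := exists_pos_mul_hexRot hang hturn
      refine ⟨q * r, mul_pos hq hr, ?_⟩
      rw [← sub_eq_iff_eq_add', hqk, sub_eq_iff_eq_add'.mpr hrk]
      push_cast
      ring
  choose! ℓ hpos hstep using key
  exact ⟨B 1 - B 0, ℓ, sub_ne_zero.mpr h0.symm, hpos, hstep⟩

/-! ### The tail of a right-turning chain is trapped -/

/-- A positive multiple of the signed distance of `z` from the line through `0` and `w`; it is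
positive on the right of the line. -/
noncomputable def rightSide (w z : ℂ) : ℝ := -((starRingEnd ℂ) w * z).im

theorem continuous_rightSide (w : ℂ) : Continuous (rightSide w) := by
  unfold rightSide
  fun_prop

theorem rightSide_add (w z z' : ℂ) : rightSide w (z + z') = rightSide w z + rightSide w z' := by
  simp [rightSide]; ring

theorem rightSide_ofReal_mul (w z : ℂ) (t : ℝ) : rightSide w (t * z) = t * rightSide w z := by
  simp [rightSide]; ring

theorem rightSide_self (w : ℂ) : rightSide w w = 0 := by
  simp [rightSide]; ring

theorem rightSide_mul_hexRot (w : ℂ) : rightSide w (w * hexRot) = √3 / 2 * Complex.normSq w := by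
  simp [rightSide, hexRot, Complex.normSq_apply]; ring

theorem rightSide_hexRot_mul (w : ℂ) :
    rightSide (w * hexRot) w = -(√3 / 2 * Complex.normSq w) := by
  simp [rightSide, hexRot, Complex.normSq_apply]; ring

theorem mem_chainCurve {B : ℕ → ℂ} {a b : ℕ} {z : ℂ} :
    z ∈ chainCurve B a b ↔ ∃ i, a ≤ i ∧ i < b ∧ z ∈ segment ℝ (B i) (B (i + 1)) := by
  simp [chainCurve, and_assoc]

theorem add_mul_mem_segment {A w : ℂ} {t r : ℝ} (ht : 0 ≤ t) (htr : t ≤ r) :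
    A + t * w ∈ segment ℝ A (A + r * w) := by
  rcases (ht.trans htr).eq_or_lt with h | h
  · have : t = 0 := by linarith
    simp [this, ← h]
  · rw [segment_eq_image']
    refine ⟨t / r, ⟨by positivity, (div_le_one h).mpr htr⟩, ?_⟩
    have : (r : ℂ) ≠ 0 := by exact_mod_cast h.ne'
    simp only [add_sub_cancel_left, Complex.real_smul]
    push_cast
    field_simp

/-- A closed set `R` traps the chain `B` at the vertex `B (j + 1)`: the chain has reached `R`, its
next edge points into `R`, and on the frontier of `R` the only points that are neither on the chain
nor on the barrier `L` are on the prolongation of the edge that ends at `B (j + 1)`. -/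
structure IsTrap (B : ℕ → ℂ) (d : ℂ) (L R : Set ℂ) (j : ℕ) : Prop where
  isClosed : IsClosed R
  mem : B (j + 1) ∈ R
  right : ∀ z ∈ R, 0 ≤ rightSide (d * hexRot ^ j) (z - B j)
  inward : ∃ ε : ℝ, 0 < ε ∧ ∀ t : ℝ, 0 < t → t ≤ ε → B (j + 1) + t * (d * hexRot ^ (j + 1)) ∈ R
  frontier_subset : frontier R ⊆ chainCurve B 0 (j + 1) ∪ L ∪
    {z | ∃ t : ℝ, 0 ≤ t ∧ z = B (j + 1) + t * (d * hexRot ^ j)}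

/-- A point of the interior of `R` allows a small step in any direction. -/
theorem exists_step_of_mem_interior {R : Set ℂ} {z : ℂ} (hz : z ∈ interior R) (w : ℂ) :
    ∃ ε : ℝ, 0 < ε ∧ ∀ t : ℝ, 0 < t → t ≤ ε → z + t * w ∈ R := by
  have hcont : Continuous fun t : ℝ => z + t * w := by fun_prop
  have hmem : (fun t : ℝ => z + t * w) ⁻¹' interior R ∈ nhds (0 : ℝ) :=
    (isOpen_interior.preimage hcont).mem_nhds (by simpa using hz)
  obtain ⟨ε, hε, hball⟩ := Metric.mem_nhds_iff.mp hmem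
  refine ⟨ε / 2, by positivity, fun t ht ht' => interior_subset (hball (a := t) ?_)⟩
  rw [Metric.mem_ball, Real.dist_eq, sub_zero, abs_of_pos ht]
  linarith

/-- The inductive step of the trapping argument: the next edge runs into the interior of `R`, and
cutting `R` by the line of this edge adds to the frontier only points of the edge and of its
prolongation. -/
theorem IsTrap.step {B : ℕ → ℂ} {d : ℂ} {ℓ : ℕ → ℝ} {N : ℕ} (hB : IsHexChain B d ℓ N)
    (hs : IsSimpleChain B 0 N) {L R : Set ℂ} {j : ℕ} (hj : j + 1 < N) (hR : IsTrap B d L R j)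
    (hL : ∀ z ∈ segment ℝ (B (j + 1)) (B (j + 2)), z ∉ L) :
    IsTrap B d L (R ∩ {z | 0 ≤ rightSide (d * hexRot ^ (j + 1)) (z - B (j + 1))}) (j + 1) := by
  set w := d * hexRot ^ j with hw
  have hw' : d * hexRot ^ (j + 1) = w * hexRot := by rw [hw, pow_succ, mul_assoc]
  have hw0 : w ≠ 0 := mul_ne_zero hB.ne_zero (pow_ne_zero _ hexRot_ne_zero)
  have hn : 0 < √3 / 2 * Complex.normSq w := by
    have := sqrt_three_pos
    have := Complex.normSq_pos.mpr hw0
    positivity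
  have hlen : 0 < ℓ (j + 1) := hB.pos _ hj
  have hnext : B (j + 2) = B (j + 1) + ℓ (j + 1) * (w * hexRot) := by
    rw [← hw']; exact hB.step _ hj
  have hin := hR.inward
  rw [hw'] at hin ⊢
  -- Each part of the frontier is excluded separately: old edges by simplicity, `L` by assumption,
  -- and the prolongation because the new edge lies strictly to the right of it. The start `t = 0`
  -- is left out, as it may lie on the frontier.
  have havoid : ∀ t : ℝ, 0 < t → t ≤ ℓ (j + 1) →
      B (j + 1) + t * (w * hexRot) ∉ frontier R := by
    intro t ht htl hmem
    have hseg : B (j + 1) + t * (w * hexRot) ∈ segment ℝ (B (j + 1)) (B (j + 2)) := by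
      rw [hnext]; exact add_mul_mem_segment ht.le htl
    rcases hR.frontier_subset hmem with (hc | hc) | ⟨s, hs0, hc⟩
    · obtain ⟨i, -, hi, hz⟩ := mem_chainCurve.mp hc
      have := (hs.2 i (j + 1) (Nat.zero_le _) hi hj _ hz hseg).2
      rw [add_eq_left] at this
      rcases mul_eq_zero.mp this with h | h
      · exact ht.ne' (by exact_mod_cast h)
      · exact mul_ne_zero hw0 hexRot_ne_zero h
    · exact hL _ hseg hc
    · have h1 : (t : ℂ) * (w * hexRot) = s * w := add_left_cancel hc
      have h2 := congrArg (rightSide w) h1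
      rw [rightSide_ofReal_mul, rightSide_ofReal_mul, rightSide_self,
        rightSide_mul_hexRot] at h2
      have := mul_pos ht hn
      linarith
  have hint : B (j + 2) ∈ interior R := by
    set S := (fun t : ℝ => B (j + 1) + t * (w * hexRot)) '' Set.Ioc 0 (ℓ (j + 1)) with hS
    have hSpre : IsPreconnected S :=
      isPreconnected_Ioc.image _ (by fun_prop)
    obtain ⟨ε, hε, hεR⟩ := hin
    refine hSpre.subset_interior_of_disjoint_frontier hR.isClosed ?_ ?_ ?_
    · rintro _ ⟨t, ht, rfl⟩
      exact havoid t ht.1 ht.2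
    · exact ⟨_, ⟨min ε (ℓ (j + 1)), ⟨lt_min hε hlen, min_le_right _ _⟩, rfl⟩,
        hεR _ (lt_min hε hlen) (min_le_left _ _)⟩
    · exact ⟨ℓ (j + 1), ⟨hlen, le_rfl⟩, hnext.symm⟩
  have hside : Continuous fun z => rightSide (w * hexRot) (z - B (j + 1)) :=
    (continuous_rightSide _).comp (by fun_prop)
  refine ⟨hR.isClosed.inter (isClosed_le continuous_const hside), ⟨interior_subset hint, ?_⟩, ?_,
    ?_, ?_⟩
  · change 0 ≤ rightSide _ (B (j + 2) - B (j + 1))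
    rw [hnext, add_sub_cancel_left, rightSide_ofReal_mul, rightSide_self, mul_zero]
  · rw [hw']
    exact fun z hz => hz.2
  · rw [pow_succ, ← mul_assoc, hw']
    obtain ⟨ε, hε, hεR⟩ := exists_step_of_mem_interior hint (w * hexRot * hexRot)
    refine ⟨ε, hε, fun t ht htε => ⟨hεR t ht htε, ?_⟩⟩
    change 0 ≤ rightSide _ (B (j + 2) + _ - B (j + 1))
    rw [hnext, show B (j + 1) + ℓ (j + 1) * (w * hexRot) + t * (w * hexRot * hexRot) - B (j + 1)
      = ℓ (j + 1) * (w * hexRot) + t * (w * hexRot * hexRot) by ring, rightSide_add,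
      rightSide_ofReal_mul, rightSide_ofReal_mul, rightSide_self, rightSide_mul_hexRot]
    have := Complex.normSq_nonneg (w * hexRot)
    have := sqrt_three_pos
    positivity
  · rw [hw']
    intro z hz
    have hzR : z ∈ R ∩ {z | 0 ≤ rightSide (w * hexRot) (z - B (j + 1))} :=
      (hR.isClosed.inter (isClosed_le continuous_const hside)).frontier_subset hz
    have hstart : B (j + 1) ∈ chainCurve B 0 (j + 1 + 1) :=
      mem_chainCurve.mpr ⟨j, Nat.zero_le _, by omega, right_mem_segment ℝ _ _⟩
    rcases frontier_inter_subset _ _ hz with ⟨hzf, -⟩ | ⟨-, hzf⟩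
    · rcases hR.frontier_subset hzf with (hc | hc) | ⟨s, hs0, hc⟩
      · obtain ⟨i, hi0, hi, hz⟩ := mem_chainCurve.mp hc
        exact Or.inl (Or.inl (mem_chainCurve.mpr ⟨i, hi0, by omega, hz⟩))
      · exact Or.inl (Or.inr hc)
      -- The old prolongation lies strictly to the left of the new edge, except for its starting
      -- point, so the cut removes it.
      · have h1 : 0 ≤ rightSide (w * hexRot) (z - B (j + 1)) := hzR.2
        rw [hc, add_sub_cancel_left, rightSide_ofReal_mul, rightSide_hexRot_mul] at h1
        have hs1 : s = 0 := by
          by_contra hne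
          have := mul_pos (lt_of_le_of_ne hs0 (Ne.symm hne)) hn
          linarith
        rw [hs1] at hc
        rw [show z = B (j + 1) by simpa using hc]
        exact Or.inl (Or.inl hstart)
    · have h0 : rightSide (w * hexRot) (z - B (j + 1)) = 0 :=
        (frontier_le_subset_eq continuous_const hside hzf).symm
      have hz1 : 0 ≤ rightSide w (z - B j) := hR.right z hzR.1
      have hBj : B (j + 1) = B j + ℓ j * w := hB.step j (by omega)
      have hww : w * hexRot ≠ 0 := mul_ne_zero hw0 hexRot_ne_zero
      obtain ⟨t, ht⟩ : ∃ t : ℝ, z = B (j + 1) + t * (w * hexRot) := by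
        refine ⟨((z - B (j + 1)) / (w * hexRot)).re, ?_⟩
        have him : ((z - B (j + 1)) / (w * hexRot)).im = 0 := by
          unfold rightSide at h0
          rw [Complex.div_im]
          simp only [Complex.mul_im, Complex.conj_re, Complex.conj_im] at h0
          rw [← sub_div]
          refine div_eq_zero_iff.mpr (Or.inl ?_)
          simp only [Complex.mul_im] at h0 ⊢
          linarith
        have : (((z - B (j + 1)) / (w * hexRot)).re : ℂ) = (z - B (j + 1)) / (w * hexRot) :=
          Complex.ext (by simp) (by simp [him])
        rw [this, div_mul_cancel₀ _ hww]
        ring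
      -- On the new line, points behind `B (j + 1)` lie to the left of the previous edge and hence
      -- outside `R`.
      have ht0 : 0 ≤ t := by
        rw [ht, hBj, show B j + ℓ j * w + t * (w * hexRot) - B j = ℓ j * w + t * (w * hexRot) by
          ring, rightSide_add, rightSide_ofReal_mul, rightSide_ofReal_mul, rightSide_self,
          rightSide_mul_hexRot, mul_zero, zero_add] at hz1
        exact nonneg_of_mul_nonneg_left hz1 hn
      rcases le_total t (ℓ (j + 1)) with h | h
      · refine Or.inl (Or.inl (mem_chainCurve.mpr ⟨j + 1, Nat.zero_le _, by omega, ?_⟩))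
        rw [ht, hnext]
        exact add_mul_mem_segment ht0 h
      · refine Or.inr ⟨t - ℓ (j + 1), by linarith, ?_⟩
        rw [ht, hnext]
        push_cast
        ring

/-- A chain that avoids itself and the barrier `L` cannot leave a trap. -/
theorem IsTrap.mem_of_le {B : ℕ → ℂ} {d : ℂ} {ℓ : ℕ → ℝ} {N : ℕ} (hB : IsHexChain B d ℓ N)
    (hs : IsSimpleChain B 0 N) {L R : Set ℂ} {m : ℕ} (hR : IsTrap B d L R m)
    (hL : ∀ j, m < j → j < N → ∀ z ∈ segment ℝ (B j) (B (j + 1)), z ∉ L) {k : ℕ}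
    (hmk : m + 1 ≤ k) (hk : k ≤ N) : B k ∈ R := by
  obtain ⟨j, rfl⟩ : ∃ j, k = m + 1 + j := ⟨k - (m + 1), by omega⟩
  have key : ∀ j, m + 1 + j ≤ N → ∃ R' ⊆ R, IsTrap B d L R' (m + j) := by
    intro j
    induction j with
    | zero => exact fun _ => ⟨R, subset_rfl, hR⟩
    | succ j ih =>
      intro hj
      obtain ⟨R', hR', htrap⟩ := ih (by omega)
      exact ⟨_, Set.inter_subset_left.trans hR',
        htrap.step (j := m + j) hB hs (by omega) (hL (m + j + 1) (by omega) (by omega))⟩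
  obtain ⟨R', hR', htrap⟩ := key j hk
  have := hR' htrap.mem
  rwa [show m + j + 1 = m + 1 + j by omega] at this

/-! ### Exchanging edges of a Steiner minimal tree -/

theorem edgeLength_mk (x y : ℂ) : edgeLength s(x, y) = dist x y := rfl

theorem edgeLength_nonneg (e : Sym2 ℂ) : 0 ≤ edgeLength e := by
  induction e with
  | _ x y => exact dist_nonneg (x := x) (y := y)

theorem networkLength_union_le (E F : Finset (Sym2 ℂ)) :
    networkLength (E ∪ F) ≤ networkLength E + networkLength F := by
  unfold networkLength
  rw [← Finset.sum_union_inter]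
  exact le_add_of_nonneg_right (Finset.sum_nonneg fun e _ => edgeLength_nonneg e)

theorem networkLength_insert_le (e : Sym2 ℂ) (E : Finset (Sym2 ℂ)) :
    networkLength (insert e E) ≤ edgeLength e + networkLength E := by
  have := networkLength_union_le {e} E
  rwa [← Finset.insert_eq, networkLength, networkLength, Finset.sum_singleton] at this

theorem reachable_of_mem {E : Finset (Sym2 ℂ)} {x y : ℂ} (h : s(x, y) ∈ E) :
    (networkGraph E).Reachable x y := by
  by_cases hxy : x = y
  · rw [hxy]
  · exact SimpleGraph.Adj.reachable
      ((SimpleGraph.fromEdgeSet_adj _).mpr ⟨Finset.mem_coe.mpr h, hxy⟩)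

theorem reachable_of_forall_edge {E E' : Finset (Sym2 ℂ)}
    (h : ∀ x y, s(x, y) ∈ E → (networkGraph E').Reachable x y) {x y : ℂ}
    (hxy : (networkGraph E).Reachable x y) : (networkGraph E').Reachable x y := by
  obtain ⟨p⟩ := hxy
  induction p with
  | nil => exact SimpleGraph.Reachable.refl _
  | cons hadj _ ih => exact (h _ _ ((SimpleGraph.fromEdgeSet_adj _).mp hadj).1).trans ih

/-- If two edges of a Steiner minimal tree are replaced by new edges in such a way that the ends of
the removed edges remain connected, the network does not become shorter. -/
theorem IsSteinerMinimalTree.le_of_exchange {V : Finset ℂ} {E : Finset (Sym2 ℂ)}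
    (hE : IsSteinerMinimalTree V E) {x y z w : ℂ} (hxy : s(x, y) ∈ E) (hzw : s(z, w) ∈ E)
    (hne : s(x, y) ≠ s(z, w)) (F : Finset (Sym2 ℂ))
    (h₁ : (networkGraph ((E \ {s(x, y), s(z, w)}) ∪ F)).Reachable x y)
    (h₂ : (networkGraph ((E \ {s(x, y), s(z, w)}) ∪ F)).Reachable z w) :
    dist x y + dist z w ≤ networkLength F := by
  set E' := (E \ {s(x, y), s(z, w)}) ∪ F with hE'
  have hcon : Interconnects V E' := by
    intro p hp q hq
    refine reachable_of_forall_edge (fun p q hpq => ?_) (hE.1 p hp q hq)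
    by_cases hp1 : s(p, q) = s(x, y)
    · rcases Sym2.eq_iff.mp hp1 with ⟨rfl, rfl⟩ | ⟨rfl, rfl⟩
      · exact h₁
      · exact h₁.symm
    by_cases hp2 : s(p, q) = s(z, w)
    · rcases Sym2.eq_iff.mp hp2 with ⟨rfl, rfl⟩ | ⟨rfl, rfl⟩
      · exact h₂
      · exact h₂.symm
    exact reachable_of_mem (by simp [hE', hpq, hp1, hp2])
  have hle := (hE.2 E' hcon).trans (networkLength_union_le _ _)
  have hsub : ({s(x, y), s(z, w)} : Finset (Sym2 ℂ)) ⊆ E := by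
    intro e he
    rcases Finset.mem_insert.mp he with rfl | he
    · exact hxy
    · rwa [Finset.mem_singleton.mp he]
  have hsum : networkLength (E \ {s(x, y), s(z, w)}) + (dist x y + dist z w)
      = networkLength E := by
    have := Finset.sum_sdiff (f := edgeLength) hsub
    rwa [Finset.sum_pair hne] at this
  linarith

/-! ### Steiner spiral chains are simple -/

section Steiner

variable {V : Finset ℂ} {E : Finset (Sym2 ℂ)} {n : ℕ} {A : ℕ → ℂ}

theorem IsSteinerSpiralChain.mem_edges (h : IsSteinerSpiralChain V E n A) {i : ℕ} (hi : i < n) :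
    s(A i, A (i + 1)) ∈ E :=
  Finset.mem_coe.mp ((SimpleGraph.fromEdgeSet_adj _).mp (h.adj i hi)).1

theorem IsSteinerSpiralChain.ne (h : IsSteinerSpiralChain V E n A) {i : ℕ} (hi : i < n) :
    A i ≠ A (i + 1) := (h.adj i hi).ne

/-- Consecutive edges of the chain meet only in their common vertex. -/
theorem eq_of_mem_consecutive {P Q R z : ℂ} (hang : ∠ P Q R = 2 * Real.pi / 3)
    (hturn : IsRightTurn P Q R) (h₁ : z ∈ segment ℝ P Q) (h₂ : z ∈ segment ℝ Q R) : z = Q := by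
  obtain ⟨r, hr, hR⟩ := exists_pos_mul_hexRot hang hturn
  have hw : Q - P ≠ 0 := by
    intro h
    simp [IsRightTurn, h] at hturn
  rw [segment_symm, segment_eq_image'] at h₁
  rw [segment_eq_image'] at h₂
  obtain ⟨s, hs, rfl⟩ := h₁
  obtain ⟨t, ht, h⟩ := h₂
  simp only [Complex.real_smul] at h
  rw [hR] at h
  have h1 : ((t * r : ℝ) : ℂ) * ((Q - P) * hexRot) = ((-s : ℝ) : ℂ) * (Q - P) := by
    push_cast
    linear_combination h
  have h2 := congrArg (rightSide (Q - P)) h1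
  rw [rightSide_ofReal_mul, rightSide_ofReal_mul, rightSide_self, rightSide_mul_hexRot] at h2
  have hn : √3 / 2 * Complex.normSq (Q - P) ≠ 0 := by
    have := sqrt_three_pos
    have := Complex.normSq_pos.mpr hw
    positivity
  have ht0 : t = 0 := by
    rw [mul_zero] at h2
    rcases mul_eq_zero.mp h2 with h3 | h3
    · exact (mul_eq_zero.mp h3).resolve_right hr.ne'
    · exact absurd h3 hn
  change Q + s • (P - Q) = Q
  rw [Complex.real_smul, ← h, ht0]
  simp

/-- In a simple stretch of the chain, followed by one more edge, all edges are different. -/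
theorem IsSteinerSpiralChain.edge_ne (h : IsSteinerSpiralChain V E n A) {j : ℕ} (hj : j < n)
    (hs : IsSimpleChain A 0 j) {i k : ℕ} (hik : i < k) (hk : k ≤ j) :
    s(A i, A (i + 1)) ≠ s(A k, A (k + 1)) := by
  intro heq
  have hmem : A k ∈ segment ℝ (A i) (A (i + 1)) := by
    rcases Sym2.eq_iff.mp heq with ⟨h1, -⟩ | ⟨-, h2⟩
    · rw [← h1]; exact left_mem_segment ℝ _ _
    · rw [← h2]; exact right_mem_segment ℝ _ _
  obtain ⟨l, rfl⟩ : ∃ l, k = l + 1 := ⟨k - 1, by omega⟩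
  rcases Nat.lt_or_ge i l with hil | hil
  · exact h.ne (by omega : l < n)
      (hs.2 i l (Nat.zero_le _) hil (by omega) _ hmem (right_mem_segment ℝ _ _)).2.symm
  · obtain rfl : i = l := by omega
    obtain ⟨hang, hturn⟩ := h.turn i (Nat.zero_le _) (by omega)
    have h2 : A i ∈ segment ℝ (A (i + 1)) (A (i + 1 + 1)) := by
      rcases Sym2.eq_iff.mp heq with ⟨h1, -⟩ | ⟨h1, -⟩
      · rw [h1]; exact left_mem_segment ℝ _ _
      · rw [h1]; exact right_mem_segment ℝ _ _
    exact h.ne (by omega : i < n)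
      (eq_of_mem_consecutive hang hturn (left_mem_segment ℝ _ _) h2)

/-- The chain connects its vertices in every network that contains its edges. -/
theorem reachable_chain {E' : Finset (Sym2 ℂ)} {a b : ℕ} (hab : a ≤ b)
    (h : ∀ i, a ≤ i → i < b → s(A i, A (i + 1)) ∈ E') :
    (networkGraph E').Reachable (A a) (A b) := by
  induction b, hab using Nat.le_induction with
  | base => exact SimpleGraph.Reachable.refl _
  | succ b hab ih =>
    exact (ih fun i hi hib => h i hi (by omega)).trans (reachable_of_mem (h b hab (by omega)))

/-- Induction over the edges. If the new edge `k` meets an earlier nonconsecutive edge `i` in `z`,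
split edge `i` at `z` and keep only the part of edge `k` from `z` to `A (k + 1)`. The vertex `A k`
remains connected through the chain from `A (i + 1)`, and the length `|A_k z| > 0` is saved.
Simplicity of the earlier stretch ensures that the edges in between differ from the two removed
ones. -/
theorem IsSteinerSpiralChain.isSimpleChain_of_le (h : IsSteinerSpiralChain V E n A) {j : ℕ}
    (hj : j ≤ n) : IsSimpleChain A 0 j := by
  induction j with
  | zero => exact ⟨fun i _ hi => absurd hi (Nat.not_lt_zero _),
      fun i j _ _ hj => absurd hj (Nat.not_lt_zero _)⟩
  | succ j ih =>
    have hs := ih (by omega)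
    refine ⟨fun i _ hi => h.ne (by omega), fun i k hi0 hik hkj z hz hz' => ?_⟩
    rcases Nat.lt_or_ge k j with hk | hk
    · exact hs.2 i k hi0 hik hk z hz hz'
    obtain rfl : k = j := by omega
    rcases (Nat.succ_le_of_lt hik).eq_or_lt with hk | hk
    · subst hk
      obtain ⟨hang, hturn⟩ := h.turn i hi0 (by omega)
      exact ⟨rfl, eq_of_mem_consecutive hang hturn hz hz'⟩
    exfalso
    -- This makes the saving strict: `A k` lies on edge `k - 1`, and earlier edges reach that edge
    -- at most in `A (k - 1)`.
    have hzk : z ≠ A k := by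
      rintro rfl
      obtain ⟨l, rfl⟩ : ∃ l, k = l + 1 := ⟨k - 1, by omega⟩
      exact h.ne (by omega : l < n)
        (hs.2 i l hi0 (by omega) (by omega) _ hz (right_mem_segment ℝ _ _)).2.symm
    set E' := (E \ {s(A i, A (i + 1)), s(A k, A (k + 1))}) ∪
      {s(A i, z), s(z, A (i + 1)), s(z, A (k + 1))} with hE'
    have r1 : (networkGraph E').Reachable (A i) z := reachable_of_mem (by simp [hE'])
    have r2 : (networkGraph E').Reachable z (A (i + 1)) := reachable_of_mem (by simp [hE'])
    have r3 : (networkGraph E').Reachable z (A (k + 1)) := reachable_of_mem (by simp [hE'])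
    have r4 : (networkGraph E').Reachable (A (i + 1)) (A k) := by
      refine reachable_chain (by omega) fun l hl hlk => ?_
      have h1 := h.edge_ne (by omega : k < n) hs (by omega : i < l) (by omega)
      have h2 := h.edge_ne (by omega : k < n) hs hlk le_rfl
      have h3 := h.mem_edges (by omega : l < n)
      rw [hE', Finset.mem_union, Finset.mem_sdiff, Finset.mem_insert, Finset.mem_singleton]
      exact Or.inl ⟨h3, by rintro (h4 | h4); exacts [h1 h4.symm, h2 h4]⟩
    have hle := h.minimal.le_of_exchange (h.mem_edges (by omega : i < n))
      (h.mem_edges (by omega : k < n)) (h.edge_ne (by omega : k < n) hs hik le_rfl)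
      {s(A i, z), s(z, A (i + 1)), s(z, A (k + 1))} (r1.trans r2)
      ((r4.symm.trans r2.symm).trans r3)
    have hF : networkLength {s(A i, z), s(z, A (i + 1)), s(z, A (k + 1))} ≤
        dist (A i) z + (dist z (A (i + 1)) + dist z (A (k + 1))) := by
      refine (networkLength_insert_le _ _).trans ?_
      gcongr
      · exact le_rfl
      refine (networkLength_insert_le _ _).trans ?_
      simp [networkLength, edgeLength_mk]
    have d1 := dist_add_dist_of_mem_segment hz
    have d2 := dist_add_dist_of_mem_segment hz'
    have d3 := dist_pos.mpr hzk.symm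
    linarith

/-- If a later edge of the chain touches the segment from `A u` to `H`, this segment is at least as
long as any edge in between. -/
theorem IsSteinerSpiralChain.le_dist_of_touch (h : IsSteinerSpiralChain V E n A) {u s j : ℕ}
    (hus : u < s) (hsj : s ≤ j) (hj : j < n) {H z : ℂ} (hz : z ∈ segment ℝ (A j) (A (j + 1)))
    (hzH : z ∈ segment ℝ H (A u)) : dist (A (s - 1)) (A s) ≤ dist (A u) H := by
  obtain ⟨r, rfl⟩ : ∃ r, s = r + 1 := ⟨s - 1, by omega⟩
  rw [Nat.add_sub_cancel]
  have hs : IsSimpleChain A 0 j := h.isSimpleChain_of_le hj.le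
  -- Edge `j` is split at `z`, edge `r` is dropped, and `A u` is joined to `z`. The ends of edge `r`
  -- stay connected along the chain from `A r` back to `A u`, over `z` to `A j`, and along the chain
  -- back to `A (r + 1)`.
  set E' := (E \ {s(A r, A (r + 1)), s(A j, A (j + 1))}) ∪
    {s(A j, z), s(z, A (j + 1)), s(A u, z)} with hE'
  have hkeep : ∀ l ≤ j, l ≠ r → l ≠ j → s(A l, A (l + 1)) ∈ E' := by
    intro l hl hlr hlj
    have h1 : s(A l, A (l + 1)) ≠ s(A r, A (r + 1)) := by
      rcases lt_or_gt_of_ne hlr with h1 | h1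
      · exact h.edge_ne hj hs h1 (by omega)
      · exact (h.edge_ne hj hs h1 (by omega)).symm
    have h2 := h.edge_ne hj hs (by omega : l < j) le_rfl
    rw [hE', Finset.mem_union, Finset.mem_sdiff, Finset.mem_insert, Finset.mem_singleton]
    exact Or.inl ⟨h.mem_edges (by omega), by rintro (h4 | h4); exacts [h1 h4, h2 h4]⟩
  have r1 : (networkGraph E').Reachable (A j) z := reachable_of_mem (by simp [hE'])
  have r2 : (networkGraph E').Reachable z (A (j + 1)) := reachable_of_mem (by simp [hE'])
  have r3 : (networkGraph E').Reachable (A u) z := reachable_of_mem (by simp [hE'])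
  have r4 : (networkGraph E').Reachable (A u) (A r) :=
    reachable_chain (by omega) fun l _ _ => hkeep l (by omega) (by omega) (by omega)
  have r5 : (networkGraph E').Reachable (A (r + 1)) (A j) :=
    reachable_chain (by omega) fun l _ _ => hkeep l (by omega) (by omega) (by omega)
  have hle := h.minimal.le_of_exchange (h.mem_edges (by omega : r < n)) (h.mem_edges hj)
    (h.edge_ne hj hs (by omega : r < j) le_rfl) {s(A j, z), s(z, A (j + 1)), s(A u, z)}
    (((r4.symm.trans r3).trans r1.symm).trans r5.symm) (r1.trans r2)
  have hF : networkLength {s(A j, z), s(z, A (j + 1)), s(A u, z)} ≤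
      dist (A j) z + (dist z (A (j + 1)) + dist (A u) z) := by
    refine (networkLength_insert_le _ _).trans ?_
    gcongr
    · exact le_rfl
    refine (networkLength_insert_le _ _).trans ?_
    simp [networkLength, edgeLength_mk]
  have d1 := dist_add_dist_of_mem_segment hz
  have d2 := dist_add_dist_of_mem_segment hzH
  rw [dist_comm H z, dist_comm H (A u), dist_comm z (A u)] at d2
  have d3 : 0 ≤ dist z H := dist_nonneg
  linarith

end Steiner

/-! ### Coordinates adapted to the six directions -/

/-- The first coordinate of `z` in the affine frame with origin `o` and axes `d`, `d * hexRot`. -/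
noncomputable def hexX (o d z : ℂ) : ℝ := ((z - o) / d).re + ((z - o) / d).im / √3

/-- The second coordinate of `z` in the affine frame with origin `o` and axes `d`, `d * hexRot`. -/
noncomputable def hexY (o d z : ℂ) : ℝ := -(2 / √3) * ((z - o) / d).im

@[fun_prop]
theorem continuous_hexX (o d : ℂ) : Continuous (hexX o d) := by
  unfold hexX
  have h : Continuous fun z : ℂ => (z - o) / d := by fun_prop
  exact (Complex.continuous_re.comp h).add ((Complex.continuous_im.comp h).div_const _)

@[fun_prop]
theorem continuous_hexY (o d : ℂ) : Continuous (hexY o d) := by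
  unfold hexY
  have h : Continuous fun z : ℂ => (z - o) / d := by fun_prop
  exact continuous_const.mul (Complex.continuous_im.comp h)

theorem hex_repr {d : ℂ} (hd : d ≠ 0) (o z : ℂ) :
    z = o + d * (hexX o d z + hexY o d z * hexRot) := by
  have h : (hexX o d z + hexY o d z * hexRot : ℂ) = (z - o) / d := by
    have h3 := sqrt_three_pos.ne'
    apply Complex.ext
    · simp only [hexX, hexY, hexRot, Complex.add_re, Complex.ofReal_re, Complex.re_ofReal_mul]
      field_simp
      ring
    · simp only [hexX, hexY, hexRot, Complex.add_im, Complex.ofReal_im, Complex.im_ofReal_mul]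
      field_simp
      ring
  rw [h, mul_div_cancel₀ _ hd]
  ring

theorem hex_ext {o d z w : ℂ} (hd : d ≠ 0) (hX : hexX o d z = hexX o d w)
    (hY : hexY o d z = hexY o d w) : z = w := by
  rw [hex_repr hd o z, hex_repr hd o w, hX, hY]

theorem hexX_self (o d : ℂ) : hexX o d o = 0 := by simp [hexX]

theorem hexY_self (o d : ℂ) : hexY o d o = 0 := by simp [hexY]

theorem hexX_add {o d : ℂ} (hd : d ≠ 0) (z : ℂ) (t p q : ℝ) :
    hexX o d (z + t * (d * (p + q * hexRot))) = hexX o d z + t * p := by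
  have h : (z + t * (d * (p + q * hexRot)) - o) / d
      = (z - o) / d + ((t : ℝ) : ℂ) * (p + q * hexRot) := by
    field_simp
    ring
  have h3 := sqrt_three_pos.ne'
  rw [hexX, h, hexX]
  simp only [hexRot, Complex.add_re, Complex.add_im, Complex.ofReal_re,
    Complex.ofReal_im, Complex.re_ofReal_mul, Complex.im_ofReal_mul]
  field_simp
  ring

theorem hexY_add {o d : ℂ} (hd : d ≠ 0) (z : ℂ) (t p q : ℝ) :
    hexY o d (z + t * (d * (p + q * hexRot))) = hexY o d z + t * q := by
  have h : (z + t * (d * (p + q * hexRot)) - o) / d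
      = (z - o) / d + ((t : ℝ) : ℂ) * (p + q * hexRot) := by
    field_simp
    ring
  have h3 := sqrt_three_pos.ne'
  rw [hexY, h, hexY]
  simp only [hexRot, Complex.add_im, Complex.ofReal_im, Complex.im_ofReal_mul]
  field_simp
  ring

theorem isBounded_of_hex {o d : ℂ} (hd : d ≠ 0) {K : Set ℂ} (C : ℝ)
    (hX : ∀ z ∈ K, |hexX o d z| ≤ C) (hY : ∀ z ∈ K, |hexY o d z| ≤ C) :
    Bornology.IsBounded K := by
  refine (Metric.isBounded_closedBall (x := (0 : ℂ))
    (r := ‖o‖ + ‖d‖ * (C + C * ‖hexRot‖))).subset fun z hz => ?_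
  rw [mem_closedBall_zero_iff, hex_repr hd o z]
  refine (norm_add_le _ _).trans ?_
  rw [norm_mul]
  gcongr
  refine (norm_add_le _ _).trans ?_
  rw [norm_mul, Complex.norm_real, Complex.norm_real]
  gcongr
  · exact hX z hz
  · exact hY z hz

theorem sub_eq_hex {o d : ℂ} (hd : d ≠ 0) (z w : ℂ) :
    z - w = d * ((hexX o d z - hexX o d w : ℝ) + (hexY o d z - hexY o d w : ℝ) * hexRot) := by
  nth_rewrite 1 [hex_repr hd o z, hex_repr hd o w]
  push_cast
  ring

theorem rightSide_hex {o d : ℂ} (hd : d ≠ 0) (z w : ℂ) (p q : ℝ) :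
    rightSide (d * (p + q * hexRot)) (z - w) = √3 / 2 * Complex.normSq d *
      (p * (hexY o d z - hexY o d w) - q * (hexX o d z - hexX o d w)) := by
  rw [sub_eq_hex (o := o) hd z w]
  simp only [rightSide, hexRot, Complex.normSq_apply, map_mul, map_add, Complex.conj_ofReal,
    Complex.mul_im, Complex.mul_re, Complex.add_re, Complex.add_im, Complex.ofReal_re,
    Complex.ofReal_im, Complex.conj_re, Complex.conj_im]
  ring

theorem rightSide_nonneg_iff {o d : ℂ} (hd : d ≠ 0) (z w : ℂ) (p q : ℝ) :
    0 ≤ rightSide (d * (p + q * hexRot)) (z - w) ↔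
      q * (hexX o d z - hexX o d w) ≤ p * (hexY o d z - hexY o d w) := by
  have h : 0 < √3 / 2 * Complex.normSq d := by
    have := sqrt_three_pos
    have := Complex.normSq_pos.mpr hd
    positivity
  rw [rightSide_hex (o := o) hd, mul_nonneg_iff_of_pos_left h, sub_nonneg]

/-- The two axes have equal length and make an angle of `60°`, hence the factor `1 / 2` on the mixed
terms. -/
theorem inner_hex {o d : ℂ} (hd : d ≠ 0) (z w : ℂ) (p q : ℝ) :
    inner ℝ (z - w) (d * (p + q * hexRot)) = Complex.normSq d *
      ((hexX o d z - hexX o d w) * p + (hexY o d z - hexY o d w) * q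
        + ((hexX o d z - hexX o d w) * q + (hexY o d z - hexY o d w) * p) / 2) := by
  rw [sub_eq_hex (o := o) hd z w, Complex.inner]
  simp only [hexRot, Complex.normSq_apply, map_mul, map_add, Complex.conj_ofReal,
    Complex.mul_im, Complex.mul_re, Complex.add_re, Complex.add_im, Complex.ofReal_re,
    Complex.ofReal_im, Complex.conj_re, Complex.conj_im]
  linear_combination (d.re * d.re + d.im * d.im) * (hexY o d z - hexY o d w) * q / 4 *
    sqrt_three_mul_self

theorem mem_segment_hex {o d : ℂ} (hd : d ≠ 0) {P Q z : ℂ} (s c p q : ℝ) (hs : 0 ≤ s)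
    (hsc : s ≤ c) (hX : hexX o d z = hexX o d P + s * p) (hY : hexY o d z = hexY o d P + s * q)
    (hX' : hexX o d Q = hexX o d P + c * p) (hY' : hexY o d Q = hexY o d P + c * q) :
    z ∈ segment ℝ P Q := by
  have hz : z = P + s * (d * (p + q * hexRot)) :=
    hex_ext hd (by rw [hexX_add hd, hX]) (by rw [hexY_add hd, hY])
  have hQ : Q = P + c * (d * (p + q * hexRot)) :=
    hex_ext hd (by rw [hexX_add hd, hX']) (by rw [hexY_add hd, hY'])
  rw [hz, hQ]
  exact add_mul_mem_segment hs hsc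

/-! ### Coordinates of the vertices of a chain -/

/-- `p` and `q` are the coordinates of the `k`-th power of `hexRot`. -/
def IsHexDir (k : ℕ) (p q : ℝ) : Prop := hexRot ^ k = p + q * hexRot

theorem isHexDir_zero : IsHexDir 0 1 0 := by simp [IsHexDir]

theorem isHexDir_one : IsHexDir 1 0 1 := by simp [IsHexDir]

theorem isHexDir_two : IsHexDir 2 (-1) 1 := by
  rw [IsHexDir, hexRot_sq]; push_cast; ring

theorem isHexDir_three : IsHexDir 3 (-1) 0 := by
  rw [IsHexDir, hexRot_pow_three]; push_cast; ring

theorem isHexDir_four : IsHexDir 4 0 (-1) := by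
  rw [IsHexDir, hexRot_pow_four]; push_cast; ring

theorem isHexDir_five : IsHexDir 5 1 (-1) := by
  rw [IsHexDir, hexRot_pow_five]; push_cast; ring

namespace IsHexChain

variable {B : ℕ → ℂ} {d : ℂ} {ℓ : ℕ → ℝ} {N : ℕ}

theorem hexX_succ (hB : IsHexChain B d ℓ N) {k : ℕ} (hk : k < N) {p q : ℝ}
    (h : IsHexDir k p q) (o : ℂ) : hexX o d (B (k + 1)) = hexX o d (B k) + ℓ k * p := by
  rw [hB.step k hk, h, hexX_add hB.ne_zero]

theorem hexY_succ (hB : IsHexChain B d ℓ N) {k : ℕ} (hk : k < N) {p q : ℝ}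
    (h : IsHexDir k p q) (o : ℂ) : hexY o d (B (k + 1)) = hexY o d (B k) + ℓ k * q := by
  rw [hB.step k hk, h, hexY_add hB.ne_zero]

theorem coord_one (hB : IsHexChain B d ℓ N) (hN : 0 < N) :
    hexX (B 0) d (B 1) = ℓ 0 ∧ hexY (B 0) d (B 1) = 0 := by
  rw [hB.hexX_succ hN isHexDir_zero, hB.hexY_succ hN isHexDir_zero, hexX_self, hexY_self]
  constructor <;> ring

theorem coord_two (hB : IsHexChain B d ℓ N) (hN : 1 < N) :
    hexX (B 0) d (B 2) = ℓ 0 ∧ hexY (B 0) d (B 2) = ℓ 1 := by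
  obtain ⟨h1, h2⟩ := hB.coord_one (by omega)
  rw [hB.hexX_succ hN isHexDir_one, hB.hexY_succ hN isHexDir_one, h1, h2]
  constructor <;> ring

theorem coord_three (hB : IsHexChain B d ℓ N) (hN : 2 < N) :
    hexX (B 0) d (B 3) = ℓ 0 - ℓ 2 ∧ hexY (B 0) d (B 3) = ℓ 1 + ℓ 2 := by
  obtain ⟨h1, h2⟩ := hB.coord_two (by omega)
  rw [hB.hexX_succ hN isHexDir_two, hB.hexY_succ hN isHexDir_two, h1, h2]
  constructor <;> ring

theorem coord_four (hB : IsHexChain B d ℓ N) (hN : 3 < N) :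
    hexX (B 0) d (B 4) = ℓ 0 - ℓ 2 - ℓ 3 ∧ hexY (B 0) d (B 4) = ℓ 1 + ℓ 2 := by
  obtain ⟨h1, h2⟩ := hB.coord_three (by omega)
  rw [hB.hexX_succ hN isHexDir_three, hB.hexY_succ hN isHexDir_three, h1, h2]
  constructor <;> ring

theorem coord_five (hB : IsHexChain B d ℓ N) (hN : 4 < N) :
    hexX (B 0) d (B 5) = ℓ 0 - ℓ 2 - ℓ 3 ∧ hexY (B 0) d (B 5) = ℓ 1 + ℓ 2 - ℓ 4 := by
  obtain ⟨h1, h2⟩ := hB.coord_four (by omega)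
  rw [hB.hexX_succ hN isHexDir_four, hB.hexY_succ hN isHexDir_four, h1, h2]
  constructor <;> ring

theorem coord_six (hB : IsHexChain B d ℓ N) (hN : 5 < N) :
    hexX (B 0) d (B 6) = ℓ 0 - ℓ 2 - ℓ 3 + ℓ 5 ∧
      hexY (B 0) d (B 6) = ℓ 1 + ℓ 2 - ℓ 4 - ℓ 5 := by
  obtain ⟨h1, h2⟩ := hB.coord_five (by omega)
  rw [hB.hexX_succ hN isHexDir_five, hB.hexY_succ hN isHexDir_five, h1, h2]
  constructor <;> ring

theorem mem_edge (hB : IsHexChain B d ℓ N) {k : ℕ} (hk : k < N) {p q : ℝ} (h : IsHexDir k p q)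
    {o z : ℂ} (s : ℝ) (hs : 0 ≤ s) (hsl : s ≤ ℓ k) (hX : hexX o d z = hexX o d (B k) + s * p)
    (hY : hexY o d z = hexY o d (B k) + s * q) : z ∈ segment ℝ (B k) (B (k + 1)) :=
  mem_segment_hex hB.ne_zero s (ℓ k) p q hs hsl hX hY (hB.hexX_succ hk h o) (hB.hexY_succ hk h o)

theorem mem_chain (hB : IsHexChain B d ℓ N) {k b : ℕ} (hk : k < N) (hkb : k < b) {p q : ℝ}
    (h : IsHexDir k p q) {o z : ℂ} (s : ℝ) (hs : 0 ≤ s) (hsl : s ≤ ℓ k)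
    (hX : hexX o d z = hexX o d (B k) + s * p) (hY : hexY o d z = hexY o d (B k) + s * q) :
    z ∈ chainCurve B 0 b :=
  mem_chainCurve.mpr ⟨k, Nat.zero_le _, hkb, hB.mem_edge hk h s hs hsl hX hY⟩

/-- Points of two edges that are not consecutive have different coordinates. -/
theorem coord_ne (hB : IsHexChain B d ℓ N) (hs : IsSimpleChain B 0 N) {i j : ℕ} (hij : i + 1 < j)
    (hj : j < N) {p q p' q' : ℝ} (hi : IsHexDir i p q) (hj' : IsHexDir j p' q') {o : ℂ} (s t : ℝ)
    (hs0 : 0 ≤ s) (hsl : s ≤ ℓ i) (ht0 : 0 ≤ t) (htl : t ≤ ℓ j)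
    (hX : hexX o d (B i) + s * p = hexX o d (B j) + t * p')
    (hY : hexY o d (B i) + s * q = hexY o d (B j) + t * q') : False := by
  have h1 : B j + t * (d * (p' + q' * hexRot)) ∈ segment ℝ (B j) (B (j + 1)) :=
    hB.mem_edge (o := o) hj hj' t ht0 htl (hexX_add hB.ne_zero _ _ _ _)
      (hexY_add hB.ne_zero _ _ _ _)
  have h2 : B j + t * (d * (p' + q' * hexRot)) ∈ segment ℝ (B i) (B (i + 1)) :=
    hB.mem_edge (o := o) (by omega) hi s hs0 hsl
      (by rw [hexX_add hB.ne_zero, hX]) (by rw [hexY_add hB.ne_zero, hY])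
  have := (hs.2 i j (Nat.zero_le _) (by omega) hj _ h2 h1).1
  omega

/-! ### Traps given by coordinates -/

/-- The open set `S` collects the conditions on `R` that hold strictly at `B (m + 1)`. Near this
vertex `R` is then just the right half-plane of edge `m`, into which the next edge points. -/
theorem isTrap (hB : IsHexChain B d ℓ N) {m : ℕ} (hm : m < N) {p q : ℝ} (h : IsHexDir m p q)
    {o : ℂ} {L R : Set ℂ} (hR : IsClosed R) (S : Set ℂ) (hS : IsOpen S) (hmem : B (m + 1) ∈ S)
    (hSR : ∀ z ∈ S, q * (hexX o d z - hexX o d (B m)) ≤ p * (hexY o d z - hexY o d (B m)) → z ∈ R)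
    (hright : ∀ z ∈ R,
      q * (hexX o d z - hexX o d (B m)) ≤ p * (hexY o d z - hexY o d (B m)))
    (hf : frontier R ⊆ chainCurve B 0 (m + 1) ∪ L ∪
      {z | ∃ t : ℝ, 0 ≤ t ∧ z = B (m + 1) + t * (d * hexRot ^ m)}) : IsTrap B d L R m := by
  have hiff : ∀ z, 0 ≤ rightSide (d * hexRot ^ m) (z - B m) ↔
      q * (hexX o d z - hexX o d (B m)) ≤ p * (hexY o d z - hexY o d (B m)) := fun z => by
    rw [h, rightSide_nonneg_iff (o := o) hB.ne_zero]
  refine ⟨hR, hSR _ hmem ?_, fun z hz => (hiff z).mpr (hright z hz), ?_, hf⟩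
  · rw [hB.hexX_succ hm h, hB.hexY_succ hm h]
    linarith
  · obtain ⟨ε, hε, hstep⟩ := exists_step_of_mem_interior (hS.interior_eq.symm ▸ hmem)
      (d * hexRot ^ (m + 1))
    refine ⟨ε, hε, fun t ht htε => hSR _ (hstep t ht htε) ((hiff _).mp ?_)⟩
    have hw : d * hexRot ^ (m + 1) = d * hexRot ^ m * hexRot := by rw [pow_succ, mul_assoc]
    rw [hB.step m hm, hw, show B m + ℓ m * (d * hexRot ^ m) + t * (d * hexRot ^ m * hexRot) - B m
      = ℓ m * (d * hexRot ^ m) + t * (d * hexRot ^ m * hexRot) by ring, rightSide_add,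
      rightSide_ofReal_mul, rightSide_ofReal_mul, rightSide_self, rightSide_mul_hexRot, mul_zero,
      zero_add]
    have := Complex.normSq_nonneg (d * hexRot ^ m)
    have := sqrt_three_pos
    positivity

/-- A point of the ray that starts at `B m` with the direction of the `m`-th edge lies on this edge
or on its prolongation. -/
theorem mem_ray (hB : IsHexChain B d ℓ N) {m : ℕ} (hm : m < N) {t : ℝ} (ht : 0 ≤ t) (L : Set ℂ) :
    B m + t * (d * hexRot ^ m) ∈ chainCurve B 0 (m + 1) ∪ L ∪
      {z | ∃ t : ℝ, 0 ≤ t ∧ z = B (m + 1) + t * (d * hexRot ^ m)} := by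
  rcases le_total t (ℓ m) with h | h
  · refine Or.inl (Or.inl (mem_chainCurve.mpr ⟨m, Nat.zero_le _, by omega, ?_⟩))
    rw [hB.step m hm]
    exact add_mul_mem_segment ht h
  · refine Or.inr ⟨t - ℓ m, by linarith, ?_⟩
    rw [hB.step m hm]
    push_cast
    ring

theorem segment_subset_ray {P w : ℂ} {h : ℝ} (hh : 0 ≤ h) {z : ℂ}
    (hz : z ∈ segment ℝ P (P + h * w)) : ∃ t : ℝ, 0 ≤ t ∧ z = P + t * w := by
  rw [segment_eq_image'] at hz
  obtain ⟨θ, hθ, rfl⟩ := hz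
  refine ⟨θ * h, mul_nonneg hθ.1 hh, ?_⟩
  simp only [add_sub_cancel_left, Complex.real_smul]
  push_cast
  ring

/-- If the curve `B 0, …, B m, H, B 0` contains the frontier of a suitable region `K`, the chain ends
in the enclosed region. -/
theorem mem_enclosedRegion (hB : IsHexChain B d ℓ N) (hs : IsSimpleChain B 0 N) {m : ℕ}
    (hm : m < N) {p q : ℝ} (hdir : IsHexDir m p q) {H : ℂ} {h : ℝ} (hh : 0 ≤ h)
    (hH : H = B m + h * (d * hexRot ^ m))
    (hL : ∀ j, m ≤ j → j < N → ∀ z ∈ segment ℝ (B j) (B (j + 1)), z ∉ segment ℝ H (B 0))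
    {K : Set ℂ} (hK : IsClosed K) (hb : Bornology.IsBounded K)
    (hf : frontier K ⊆ chainCurve B 0 m ∪ segment ℝ (B m) H ∪ segment ℝ H (B 0))
    (S : Set ℂ) (hS : IsOpen S) (hmem : B (m + 1) ∈ S)
    (hSK : ∀ z ∈ S, q * (hexX (B 0) d z - hexX (B 0) d (B m)) ≤
      p * (hexY (B 0) d z - hexY (B 0) d (B m)) → z ∈ K)
    (hright : ∀ z ∈ K, q * (hexX (B 0) d z - hexX (B 0) d (B m)) ≤
      p * (hexY (B 0) d z - hexY (B 0) d (B m))) :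
    B N ∈ enclosedRegion (chainCurve B 0 m ∪ segment ℝ (B m) H ∪ segment ℝ H (B 0)) := by
  refine subset_enclosedRegion hb hK hf ?_
  -- The side from `B m` to `H` lies on the ray of edge `m`, so it is covered by this edge and its
  -- prolongation; the perpendicular is the barrier.
  have htrap : IsTrap B d (segment ℝ H (B 0)) K m := by
    refine hB.isTrap hm hdir hK S hS hmem hSK hright fun z hz => ?_
    rcases hf hz with (hz | hz) | hz
    · obtain ⟨i, hi0, hi, hz⟩ := mem_chainCurve.mp hz
      exact Or.inl (Or.inl (mem_chainCurve.mpr ⟨i, hi0, by omega, hz⟩))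
    · rw [hH] at hz
      obtain ⟨t, ht, rfl⟩ := segment_subset_ray hh hz
      exact hB.mem_ray hm ht _
    · exact Or.inl (Or.inr hz)
  exact htrap.mem_of_le hB hs (fun j hj hjN => hL j hj.le hjN) (by omega) le_rfl

/-- If the edges from `B m` on avoid the point `H` of the ray, the `m`-th edge ends before `H`. -/
theorem lt_of_avoids (hB : IsHexChain B d ℓ N) {m : ℕ} (hm : m < N) {H : ℂ} {h : ℝ} (hh : 0 ≤ h)
    (hH : H = B m + h * (d * hexRot ^ m))
    (hL : ∀ j, m ≤ j → j < N → ∀ z ∈ segment ℝ (B j) (B (j + 1)), z ∉ segment ℝ H (B 0)) :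
    ℓ m < h := by
  by_contra! hle
  refine hL m le_rfl hm H ?_ (left_mem_segment ℝ _ _)
  rw [hB.step m hm, hH]
  exact add_mul_mem_segment hh hle

end IsHexChain

/-! ### The polygon closed by a perpendicular -/

namespace IsHexChain

variable {B : ℕ → ℂ} {d : ℂ} {ℓ : ℕ → ℝ} {N : ℕ}

theorem coord_foot (hB : IsHexChain B d ℓ N) {m : ℕ} {p q : ℝ} (hdir : IsHexDir m p q) {H : ℂ}
    {h : ℝ} (hH : H = B m + h * (d * hexRot ^ m)) (o : ℂ) :
    hexX o d H = hexX o d (B m) + h * p ∧ hexY o d H = hexY o d (B m) + h * q := by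
  rw [hH, hdir, hexX_add hB.ne_zero, hexY_add hB.ne_zero]
  exact ⟨rfl, rfl⟩

/-- For `m = 2, 3, 4, 5` the perpendicular through `B 0` becomes the line `X = Y`, `2 X + Y = 0`, `X
+ 2 Y = 0`, `X = Y`, respectively. -/
theorem perp_coord (hB : IsHexChain B d ℓ N) {m : ℕ} {p q : ℝ} (hdir : IsHexDir m p q) {H : ℂ}
    (hperp : inner ℝ (B 0 - H) (d * hexRot ^ m) = 0) :
    hexX (B 0) d H * p + hexY (B 0) d H * q +
      (hexX (B 0) d H * q + hexY (B 0) d H * p) / 2 = 0 := by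
  rw [hdir, inner_hex (o := B 0) hB.ne_zero, hexX_self, hexY_self] at hperp
  have := (mul_eq_zero.mp hperp).resolve_left (Complex.normSq_pos.mpr hB.ne_zero).ne'
  linarith

/-- The angle at `B 1` is obtuse, so the foot falls behind `B 1`. -/
theorem foot_one_false (hB : IsHexChain B d ℓ N) (hN : 1 < N) {H : ℂ} {h : ℝ} (hh : 0 ≤ h)
    (hH : H = B 1 + h * (d * hexRot ^ 1)) (hperp : inner ℝ (B 0 - H) (d * hexRot ^ 1) = 0) :
    False := by
  obtain ⟨x1, y1⟩ := hB.coord_one (by omega)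
  obtain ⟨xH, yH⟩ := hB.coord_foot isHexDir_one hH (B 0)
  have hp := hB.perp_coord isHexDir_one hperp
  have := hB.pos 0 (by omega)
  rw [xH, yH, x1, y1] at hp
  linarith

/-- Here `K` is the convex quadrilateral `B 0, B 1, B 2, H`. As in the later cases that use a
barrier, a frontier point makes one of the defining inequalities an equality, which places it on one
side, and `S` omits the inequality of edge `m`. -/
theorem mem_enclosedRegion_two (hB : IsHexChain B d ℓ N) (hs : IsSimpleChain B 0 N) (hN : 2 < N)
    {H : ℂ} {h : ℝ} (hh : 0 ≤ h) (hH : H = B 2 + h * (d * hexRot ^ 2))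
    (hperp : inner ℝ (B 0 - H) (d * hexRot ^ 2) = 0)
    (hL : ∀ j, 2 ≤ j → j < N → ∀ z ∈ segment ℝ (B j) (B (j + 1)), z ∉ segment ℝ H (B 0)) :
    B N ∈ enclosedRegion (chainCurve B 0 2 ∪ segment ℝ (B 2) H ∪ segment ℝ H (B 0)) := by
  obtain ⟨x1, y1⟩ := hB.coord_one (by omega)
  obtain ⟨x2, y2⟩ := hB.coord_two (by omega)
  obtain ⟨x3, y3⟩ := hB.coord_three (by omega)
  obtain ⟨xH, yH⟩ := hB.coord_foot isHexDir_two hH (B 0)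
  have hp := hB.perp_coord isHexDir_two hperp
  have hlt := hB.lt_of_avoids (by omega) hh hH hL
  have x0 := hexX_self (B 0) d
  have y0 := hexY_self (B 0) d
  have p0 := hB.pos 0 (by omega)
  have p1 := hB.pos 1 (by omega)
  have p2 := hB.pos 2 (by omega)
  rw [x2] at xH
  rw [y2] at yH
  rw [xH, yH] at hp
  set K : Set ℂ := {z | 0 ≤ hexY (B 0) d z ∧ hexX (B 0) d z ≤ ℓ 0 ∧
    hexX (B 0) d z + hexY (B 0) d z ≤ ℓ 0 + ℓ 1 ∧ hexY (B 0) d z ≤ hexX (B 0) d z} with hK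
  have hKc : IsClosed K := by
    simp only [hK, Set.ofPred_and]
    repeat' first | apply IsClosed.inter | apply isClosed_le
    all_goals fun_prop
  refine hB.mem_enclosedRegion hs hN isHexDir_two hh hH hL hKc ?_ ?_
    {z | 0 < hexY (B 0) d z ∧ hexX (B 0) d z < ℓ 0 ∧ hexY (B 0) d z < hexX (B 0) d z} ?_ ?_ ?_ ?_
  · refine isBounded_of_hex (o := B 0) hB.ne_zero (ℓ 0) ?_ ?_ <;> rintro z ⟨h1, h2, h3, h4⟩ <;>
      rw [abs_le] <;> constructor <;> linarith
  · intro z hz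
    obtain ⟨⟨h1, h2, h3, h4⟩, hn⟩ := mem_of_mem_frontier hKc
      (U := {z | 0 < hexY (B 0) d z ∧ hexX (B 0) d z < ℓ 0 ∧
        hexX (B 0) d z + hexY (B 0) d z < ℓ 0 + ℓ 1 ∧ hexY (B 0) d z < hexX (B 0) d z})
      (by
        simp only [Set.ofPred_and]
        repeat' first | apply IsOpen.inter | apply isOpen_lt
        all_goals fun_prop)
      (fun z hz => ⟨hz.1.le, hz.2.1.le, hz.2.2.1.le, hz.2.2.2.le⟩) hz
    simp only [Set.mem_ofPred_eq, not_and_or, not_lt] at hn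
    rcases hn with hn | hn | hn | hn
    · refine Or.inl (Or.inl (hB.mem_chain (o := B 0) (by omega : 0 < N) (by omega) isHexDir_zero
        (hexX (B 0) d z) ?_ ?_ ?_ ?_)) <;> linarith
    · refine Or.inl (Or.inl (hB.mem_chain (o := B 0) (by omega : 1 < N) (by omega) isHexDir_one
        (hexY (B 0) d z) ?_ ?_ ?_ ?_)) <;> linarith
    · refine Or.inl (Or.inr (mem_segment_hex (o := B 0) hB.ne_zero
        (hexY (B 0) d z - ℓ 1) h (-1) 1 ?_ ?_ ?_ ?_ ?_ ?_)) <;> linarith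
    · rw [segment_symm ℝ H]
      refine Or.inr (mem_segment_hex (o := B 0) hB.ne_zero
        (hexX (B 0) d z) (ℓ 0 - h) 1 1 ?_ ?_ ?_ ?_ ?_ ?_) <;> linarith
  · simp only [Set.ofPred_and]
    repeat' first | apply IsOpen.inter | apply isOpen_lt
    all_goals fun_prop
  · refine ⟨?_, ?_, ?_⟩ <;> linarith
  · rintro z ⟨h1, h2, h3⟩ h4
    refine ⟨?_, ?_, ?_, ?_⟩ <;> linarith
  · rintro z ⟨h1, h2, h3, h4⟩
    linarith

theorem mem_enclosedRegion_three (hB : IsHexChain B d ℓ N) (hs : IsSimpleChain B 0 N) (hN : 3 < N)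
    {H : ℂ} {h : ℝ} (hh : 0 ≤ h) (hH : H = B 3 + h * (d * hexRot ^ 3))
    (hperp : inner ℝ (B 0 - H) (d * hexRot ^ 3) = 0)
    (hL : ∀ j, 3 ≤ j → j < N → ∀ z ∈ segment ℝ (B j) (B (j + 1)), z ∉ segment ℝ H (B 0)) :
    B N ∈ enclosedRegion (chainCurve B 0 3 ∪ segment ℝ (B 3) H ∪ segment ℝ H (B 0)) := by
  obtain ⟨x1, y1⟩ := hB.coord_one (by omega)
  obtain ⟨x2, y2⟩ := hB.coord_two (by omega)
  obtain ⟨x3, y3⟩ := hB.coord_three (by omega)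
  obtain ⟨x4, y4⟩ := hB.coord_four (by omega)
  obtain ⟨xH, yH⟩ := hB.coord_foot isHexDir_three hH (B 0)
  have hp := hB.perp_coord isHexDir_three hperp
  have hlt := hB.lt_of_avoids (by omega) hh hH hL
  have x0 := hexX_self (B 0) d
  have y0 := hexY_self (B 0) d
  have p0 := hB.pos 0 (by omega)
  have p1 := hB.pos 1 (by omega)
  have p2 := hB.pos 2 (by omega)
  have p3 := hB.pos 3 (by omega)
  rw [x3] at xH
  rw [y3] at yH
  rw [xH, yH] at hp
  set K : Set ℂ := {z | 0 ≤ hexY (B 0) d z ∧ hexX (B 0) d z ≤ ℓ 0 ∧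
    hexX (B 0) d z + hexY (B 0) d z ≤ ℓ 0 + ℓ 1 ∧ hexY (B 0) d z ≤ ℓ 1 + ℓ 2 ∧
    0 ≤ 2 * hexX (B 0) d z + hexY (B 0) d z} with hK
  have hKc : IsClosed K := by
    simp only [hK, Set.ofPred_and]
    repeat' first | apply IsClosed.inter | apply isClosed_le
    all_goals fun_prop
  refine hB.mem_enclosedRegion hs hN isHexDir_three hh hH hL hKc ?_ ?_
    {z | 0 < hexY (B 0) d z ∧ hexX (B 0) d z < ℓ 0 ∧
      hexX (B 0) d z + hexY (B 0) d z < ℓ 0 + ℓ 1 ∧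
      0 < 2 * hexX (B 0) d z + hexY (B 0) d z} ?_ ?_ ?_ ?_
  · refine isBounded_of_hex (o := B 0) hB.ne_zero (ℓ 0 + ℓ 1 + ℓ 2) ?_ ?_ <;>
      rintro z ⟨h1, h2, h3, h4, h5⟩ <;> rw [abs_le] <;> constructor <;> linarith
  · intro z hz
    obtain ⟨⟨h1, h2, h3, h4, h5⟩, hn⟩ := mem_of_mem_frontier hKc
      (U := {z | 0 < hexY (B 0) d z ∧ hexX (B 0) d z < ℓ 0 ∧
        hexX (B 0) d z + hexY (B 0) d z < ℓ 0 + ℓ 1 ∧ hexY (B 0) d z < ℓ 1 + ℓ 2 ∧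
        0 < 2 * hexX (B 0) d z + hexY (B 0) d z})
      (by
        simp only [Set.ofPred_and]
        repeat' first | apply IsOpen.inter | apply isOpen_lt
        all_goals fun_prop)
      (fun z hz => ⟨hz.1.le, hz.2.1.le, hz.2.2.1.le, hz.2.2.2.1.le, hz.2.2.2.2.le⟩) hz
    simp only [Set.mem_ofPred_eq, not_and_or, not_lt] at hn
    rcases hn with hn | hn | hn | hn | hn
    · refine Or.inl (Or.inl (hB.mem_chain (o := B 0) (by omega : 0 < N) (by omega) isHexDir_zero
        (hexX (B 0) d z) ?_ ?_ ?_ ?_)) <;> linarith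
    · refine Or.inl (Or.inl (hB.mem_chain (o := B 0) (by omega : 1 < N) (by omega) isHexDir_one
        (hexY (B 0) d z) ?_ ?_ ?_ ?_)) <;> linarith
    · refine Or.inl (Or.inl (hB.mem_chain (o := B 0) (by omega : 2 < N) (by omega) isHexDir_two
        (hexY (B 0) d z - ℓ 1) ?_ ?_ ?_ ?_)) <;> linarith
    · refine Or.inl (Or.inr (mem_segment_hex (o := B 0) hB.ne_zero
        (ℓ 0 - ℓ 2 - hexX (B 0) d z) h (-1) 0 ?_ ?_ ?_ ?_ ?_ ?_)) <;> linarith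
    -- On the perpendicular `X = -Y / 2`, so `Y` serves as the parameter from `B 0` to `H`.
    · rw [segment_symm ℝ H]
      refine Or.inr (mem_segment_hex (o := B 0) hB.ne_zero
        (hexY (B 0) d z) (ℓ 1 + ℓ 2) (-1 / 2) 1 ?_ ?_ ?_ ?_ ?_ ?_) <;> linarith
  · simp only [Set.ofPred_and]
    repeat' first | apply IsOpen.inter | apply isOpen_lt
    all_goals fun_prop
  · refine ⟨?_, ?_, ?_, ?_⟩ <;> linarith
  · rintro z ⟨h1, h2, h3, h4⟩ h5
    refine ⟨?_, ?_, ?_, ?_, ?_⟩ <;> linarith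
  · rintro z ⟨h1, h2, h3, h4, h5⟩
    linarith

/-- By `hside` the line of edge 4 has `X < 0`, so it passes outside edge 0 and the polygon is
convex. -/
theorem mem_enclosedRegion_four_of_lt (hB : IsHexChain B d ℓ N) (hs : IsSimpleChain B 0 N)
    (hN : 4 < N) {H : ℂ} {h : ℝ} (hh : 0 ≤ h) (hH : H = B 4 + h * (d * hexRot ^ 4))
    (hperp : inner ℝ (B 0 - H) (d * hexRot ^ 4) = 0)
    (hL : ∀ j, 4 ≤ j → j < N → ∀ z ∈ segment ℝ (B j) (B (j + 1)), z ∉ segment ℝ H (B 0))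
    (hside : ℓ 0 < ℓ 2 + ℓ 3) :
    B N ∈ enclosedRegion (chainCurve B 0 4 ∪ segment ℝ (B 4) H ∪ segment ℝ H (B 0)) := by
  obtain ⟨x1, y1⟩ := hB.coord_one (by omega)
  obtain ⟨x2, y2⟩ := hB.coord_two (by omega)
  obtain ⟨x3, y3⟩ := hB.coord_three (by omega)
  obtain ⟨x4, y4⟩ := hB.coord_four (by omega)
  obtain ⟨x5, y5⟩ := hB.coord_five (by omega)
  obtain ⟨xH, yH⟩ := hB.coord_foot isHexDir_four hH (B 0)
  have hp := hB.perp_coord isHexDir_four hperp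
  have hlt := hB.lt_of_avoids (by omega) hh hH hL
  have x0 := hexX_self (B 0) d
  have y0 := hexY_self (B 0) d
  have p0 := hB.pos 0 (by omega)
  have p1 := hB.pos 1 (by omega)
  have p2 := hB.pos 2 (by omega)
  have p3 := hB.pos 3 (by omega)
  have p4 := hB.pos 4 (by omega)
  rw [x4] at xH
  rw [y4] at yH
  rw [xH, yH] at hp
  set K : Set ℂ := {z | 0 ≤ hexY (B 0) d z ∧ hexX (B 0) d z ≤ ℓ 0 ∧
    hexX (B 0) d z + hexY (B 0) d z ≤ ℓ 0 + ℓ 1 ∧ hexY (B 0) d z ≤ ℓ 1 + ℓ 2 ∧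
    ℓ 0 - ℓ 2 - ℓ 3 ≤ hexX (B 0) d z ∧ 0 ≤ hexX (B 0) d z + 2 * hexY (B 0) d z} with hK
  have hKc : IsClosed K := by
    simp only [hK, Set.ofPred_and]
    repeat' first | apply IsClosed.inter | apply isClosed_le
    all_goals fun_prop
  refine hB.mem_enclosedRegion hs hN isHexDir_four hh hH hL hKc ?_ ?_
    {z | 0 < hexY (B 0) d z ∧ hexX (B 0) d z < ℓ 0 ∧
      hexX (B 0) d z + hexY (B 0) d z < ℓ 0 + ℓ 1 ∧ hexY (B 0) d z < ℓ 1 + ℓ 2 ∧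
      0 < hexX (B 0) d z + 2 * hexY (B 0) d z} ?_ ?_ ?_ ?_
  · refine isBounded_of_hex (o := B 0) hB.ne_zero (ℓ 0 + ℓ 1 + ℓ 2 + ℓ 3) ?_ ?_ <;>
      rintro z ⟨h1, h2, h3, h4, h5, h6⟩ <;> rw [abs_le] <;> constructor <;> linarith
  · intro z hz
    obtain ⟨⟨h1, h2, h3, h4, h5, h6⟩, hn⟩ := mem_of_mem_frontier hKc
      (U := {z | 0 < hexY (B 0) d z ∧ hexX (B 0) d z < ℓ 0 ∧
        hexX (B 0) d z + hexY (B 0) d z < ℓ 0 + ℓ 1 ∧ hexY (B 0) d z < ℓ 1 + ℓ 2 ∧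
        ℓ 0 - ℓ 2 - ℓ 3 < hexX (B 0) d z ∧ 0 < hexX (B 0) d z + 2 * hexY (B 0) d z})
      (by
        simp only [Set.ofPred_and]
        repeat' first | apply IsOpen.inter | apply isOpen_lt
        all_goals fun_prop)
      (fun z hz => ⟨hz.1.le, hz.2.1.le, hz.2.2.1.le, hz.2.2.2.1.le, hz.2.2.2.2.1.le,
        hz.2.2.2.2.2.le⟩) hz
    simp only [Set.mem_ofPred_eq, not_and_or, not_lt] at hn
    rcases hn with hn | hn | hn | hn | hn | hn
    · refine Or.inl (Or.inl (hB.mem_chain (o := B 0) (by omega : 0 < N) (by omega) isHexDir_zero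
        (hexX (B 0) d z) ?_ ?_ ?_ ?_)) <;> linarith
    · refine Or.inl (Or.inl (hB.mem_chain (o := B 0) (by omega : 1 < N) (by omega) isHexDir_one
        (hexY (B 0) d z) ?_ ?_ ?_ ?_)) <;> linarith
    · refine Or.inl (Or.inl (hB.mem_chain (o := B 0) (by omega : 2 < N) (by omega) isHexDir_two
        (hexY (B 0) d z - ℓ 1) ?_ ?_ ?_ ?_)) <;> linarith
    · refine Or.inl (Or.inl (hB.mem_chain (o := B 0) (by omega : 3 < N) (by omega) isHexDir_three
        (ℓ 0 - ℓ 2 - hexX (B 0) d z) ?_ ?_ ?_ ?_)) <;> linarith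
    · refine Or.inl (Or.inr (mem_segment_hex (o := B 0) hB.ne_zero
        (ℓ 1 + ℓ 2 - hexY (B 0) d z) h 0 (-1) ?_ ?_ ?_ ?_ ?_ ?_)) <;> linarith
    · rw [segment_symm ℝ H]
      refine Or.inr (mem_segment_hex (o := B 0) hB.ne_zero
        (-hexX (B 0) d z) (ℓ 2 + ℓ 3 - ℓ 0) (-1) (1 / 2) ?_ ?_ ?_ ?_ ?_ ?_) <;> linarith
  · simp only [Set.ofPred_and]
    repeat' first | apply IsOpen.inter | apply isOpen_lt
    all_goals fun_prop
  · refine ⟨?_, ?_, ?_, ?_, ?_⟩ <;> linarith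
  · rintro z ⟨h1, h2, h3, h4, h5⟩ h6
    refine ⟨?_, ?_, ?_, ?_, ?_, ?_⟩ <;> linarith
  · rintro z ⟨h1, h2, h3, h4, h5, h6⟩
    linarith

/-- Now the segment from `B 4` to `H` reaches edge 0, and the closed curve may cross itself. The
trap is the pentagon bounded by the chain and this segment up to edge 0; the perpendicular plays no
part in its frontier. -/
theorem mem_enclosedRegion_four_of_ge (hB : IsHexChain B d ℓ N) (hs : IsSimpleChain B 0 N)
    (hN : 4 < N) {H : ℂ} {h : ℝ} (hh : 0 ≤ h) (hH : H = B 4 + h * (d * hexRot ^ 4))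
    (hperp : inner ℝ (B 0 - H) (d * hexRot ^ 4) = 0)
    (hL : ∀ j, 4 ≤ j → j < N → ∀ z ∈ segment ℝ (B j) (B (j + 1)), z ∉ segment ℝ H (B 0))
    (hside : ℓ 2 + ℓ 3 ≤ ℓ 0) :
    B N ∈ enclosedRegion (chainCurve B 0 4 ∪ segment ℝ (B 4) H ∪ segment ℝ H (B 0)) := by
  obtain ⟨x1, y1⟩ := hB.coord_one (by omega)
  obtain ⟨x2, y2⟩ := hB.coord_two (by omega)
  obtain ⟨x3, y3⟩ := hB.coord_three (by omega)
  obtain ⟨x4, y4⟩ := hB.coord_four (by omega)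
  obtain ⟨x5, y5⟩ := hB.coord_five (by omega)
  obtain ⟨xH, yH⟩ := hB.coord_foot isHexDir_four hH (B 0)
  have hp := hB.perp_coord isHexDir_four hperp
  have x0 := hexX_self (B 0) d
  have y0 := hexY_self (B 0) d
  have p0 := hB.pos 0 (by omega)
  have p1 := hB.pos 1 (by omega)
  have p2 := hB.pos 2 (by omega)
  have p3 := hB.pos 3 (by omega)
  have p4 := hB.pos 4 (by omega)
  rw [x4] at xH
  rw [y4] at yH
  rw [xH, yH] at hp
  -- A longer edge 4 would hit edge 0 in the point with coordinates `(ℓ 0 - ℓ 2 - ℓ 3, 0)`.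
  have hlt : ℓ 4 < ℓ 1 + ℓ 2 := by
    by_contra! hle
    refine hB.coord_ne (o := B 0) hs (by omega : 0 + 1 < 4) hN isHexDir_zero isHexDir_four
      (ℓ 0 - ℓ 2 - ℓ 3) (ℓ 1 + ℓ 2) ?_ ?_ ?_ ?_ ?_ ?_ <;> linarith
  set K : Set ℂ := {z | 0 ≤ hexY (B 0) d z ∧ hexX (B 0) d z ≤ ℓ 0 ∧
    hexX (B 0) d z + hexY (B 0) d z ≤ ℓ 0 + ℓ 1 ∧ hexY (B 0) d z ≤ ℓ 1 + ℓ 2 ∧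
    ℓ 0 - ℓ 2 - ℓ 3 ≤ hexX (B 0) d z} with hK
  have hKc : IsClosed K := by
    simp only [hK, Set.ofPred_and]
    repeat' first | apply IsClosed.inter | apply isClosed_le
    all_goals fun_prop
  refine hB.mem_enclosedRegion hs hN isHexDir_four hh hH hL hKc ?_ ?_
    {z | 0 < hexY (B 0) d z ∧ hexX (B 0) d z < ℓ 0 ∧
      hexX (B 0) d z + hexY (B 0) d z < ℓ 0 + ℓ 1 ∧ hexY (B 0) d z < ℓ 1 + ℓ 2} ?_ ?_ ?_ ?_
  · refine isBounded_of_hex (o := B 0) hB.ne_zero (ℓ 0 + ℓ 1 + ℓ 2 + ℓ 3) ?_ ?_ <;>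
      rintro z ⟨h1, h2, h3, h4, h5⟩ <;> rw [abs_le] <;> constructor <;> linarith
  · intro z hz
    obtain ⟨⟨h1, h2, h3, h4, h5⟩, hn⟩ := mem_of_mem_frontier hKc
      (U := {z | 0 < hexY (B 0) d z ∧ hexX (B 0) d z < ℓ 0 ∧
        hexX (B 0) d z + hexY (B 0) d z < ℓ 0 + ℓ 1 ∧ hexY (B 0) d z < ℓ 1 + ℓ 2 ∧
        ℓ 0 - ℓ 2 - ℓ 3 < hexX (B 0) d z})
      (by
        simp only [Set.ofPred_and]
        repeat' first | apply IsOpen.inter | apply isOpen_lt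
        all_goals fun_prop)
      (fun z hz => ⟨hz.1.le, hz.2.1.le, hz.2.2.1.le, hz.2.2.2.1.le, hz.2.2.2.2.le⟩) hz
    simp only [Set.mem_ofPred_eq, not_and_or, not_lt] at hn
    rcases hn with hn | hn | hn | hn | hn
    · refine Or.inl (Or.inl (hB.mem_chain (o := B 0) (by omega : 0 < N) (by omega) isHexDir_zero
        (hexX (B 0) d z) ?_ ?_ ?_ ?_)) <;> linarith
    · refine Or.inl (Or.inl (hB.mem_chain (o := B 0) (by omega : 1 < N) (by omega) isHexDir_one
        (hexY (B 0) d z) ?_ ?_ ?_ ?_)) <;> linarith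
    · refine Or.inl (Or.inl (hB.mem_chain (o := B 0) (by omega : 2 < N) (by omega) isHexDir_two
        (hexY (B 0) d z - ℓ 1) ?_ ?_ ?_ ?_)) <;> linarith
    · refine Or.inl (Or.inl (hB.mem_chain (o := B 0) (by omega : 3 < N) (by omega) isHexDir_three
        (ℓ 0 - ℓ 2 - hexX (B 0) d z) ?_ ?_ ?_ ?_)) <;> linarith
    · refine Or.inl (Or.inr (mem_segment_hex (o := B 0) hB.ne_zero
        (ℓ 1 + ℓ 2 - hexY (B 0) d z) h 0 (-1) ?_ ?_ ?_ ?_ ?_ ?_)) <;> linarith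
  · simp only [Set.ofPred_and]
    repeat' first | apply IsOpen.inter | apply isOpen_lt
    all_goals fun_prop
  · refine ⟨?_, ?_, ?_, ?_⟩ <;> linarith
  · rintro z ⟨h1, h2, h3, h4⟩ h5
    refine ⟨?_, ?_, ?_, ?_, ?_⟩ <;> linarith
  · rintro z ⟨h1, h2, h3, h4, h5⟩
    linarith

/-- The ray of edge 5 lies on `X + Y = ℓ 0 + ℓ 1 - ℓ 3 - ℓ 4 < 0` and leaves `B 0` on its right. The
polygon then has a reflex corner at `B 0`, whence the disjunction in `K`. -/
theorem mem_enclosedRegion_five_of_lt (hB : IsHexChain B d ℓ N) (hs : IsSimpleChain B 0 N)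
    (hN : 5 < N) {H : ℂ} {h : ℝ} (hh : 0 ≤ h) (hH : H = B 5 + h * (d * hexRot ^ 5))
    (hperp : inner ℝ (B 0 - H) (d * hexRot ^ 5) = 0)
    (hL : ∀ j, 5 ≤ j → j < N → ∀ z ∈ segment ℝ (B j) (B (j + 1)), z ∉ segment ℝ H (B 0))
    (hside : ℓ 0 + ℓ 1 < ℓ 3 + ℓ 4) :
    B N ∈ enclosedRegion (chainCurve B 0 5 ∪ segment ℝ (B 5) H ∪ segment ℝ H (B 0)) := by
  obtain ⟨x1, y1⟩ := hB.coord_one (by omega)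
  obtain ⟨x2, y2⟩ := hB.coord_two (by omega)
  obtain ⟨x3, y3⟩ := hB.coord_three (by omega)
  obtain ⟨x4, y4⟩ := hB.coord_four (by omega)
  obtain ⟨x5, y5⟩ := hB.coord_five (by omega)
  obtain ⟨x6, y6⟩ := hB.coord_six (by omega)
  obtain ⟨xH, yH⟩ := hB.coord_foot isHexDir_five hH (B 0)
  have hp := hB.perp_coord isHexDir_five hperp
  have hlt := hB.lt_of_avoids (by omega) hh hH hL
  have x0 := hexX_self (B 0) d
  have y0 := hexY_self (B 0) d
  have p0 := hB.pos 0 (by omega)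
  have p1 := hB.pos 1 (by omega)
  have p2 := hB.pos 2 (by omega)
  have p3 := hB.pos 3 (by omega)
  have p4 := hB.pos 4 (by omega)
  have p5 := hB.pos 5 (by omega)
  rw [x5] at xH
  rw [y5] at yH
  rw [xH, yH] at hp
  set K : Set ℂ := {z | hexX (B 0) d z ≤ ℓ 0 ∧
    hexX (B 0) d z + hexY (B 0) d z ≤ ℓ 0 + ℓ 1 ∧ hexY (B 0) d z ≤ ℓ 1 + ℓ 2 ∧
    ℓ 0 - ℓ 2 - ℓ 3 ≤ hexX (B 0) d z ∧
    ℓ 0 + ℓ 1 - ℓ 3 - ℓ 4 ≤ hexX (B 0) d z + hexY (B 0) d z ∧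
    (0 ≤ hexY (B 0) d z ∨ hexX (B 0) d z ≤ hexY (B 0) d z)} with hK
  have hKc : IsClosed K := by
    simp only [hK, Set.ofPred_and, Set.ofPred_or]
    repeat' first | apply IsClosed.inter | apply IsClosed.union | apply isClosed_le
    all_goals fun_prop
  refine hB.mem_enclosedRegion hs hN isHexDir_five hh hH hL hKc ?_ ?_
    {z | hexX (B 0) d z < ℓ 0 ∧
      hexX (B 0) d z + hexY (B 0) d z < ℓ 0 + ℓ 1 ∧ hexY (B 0) d z < ℓ 1 + ℓ 2 ∧
      ℓ 0 - ℓ 2 - ℓ 3 < hexX (B 0) d z ∧ hexX (B 0) d z < hexY (B 0) d z} ?_ ?_ ?_ ?_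
  · refine isBounded_of_hex (o := B 0) hB.ne_zero (ℓ 0 + ℓ 1 + ℓ 2 + ℓ 3 + ℓ 4) ?_ ?_ <;>
      rintro z ⟨h1, h2, h3, h4, h5, -⟩ <;> rw [abs_le] <;> constructor <;> linarith
  · intro z hz
    obtain ⟨⟨h1, h2, h3, h4, h5, h6⟩, hn⟩ := mem_of_mem_frontier hKc
      (U := {z | hexX (B 0) d z < ℓ 0 ∧
        hexX (B 0) d z + hexY (B 0) d z < ℓ 0 + ℓ 1 ∧ hexY (B 0) d z < ℓ 1 + ℓ 2 ∧
        ℓ 0 - ℓ 2 - ℓ 3 < hexX (B 0) d z ∧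
        ℓ 0 + ℓ 1 - ℓ 3 - ℓ 4 < hexX (B 0) d z + hexY (B 0) d z ∧
        (0 < hexY (B 0) d z ∨ hexX (B 0) d z < hexY (B 0) d z)})
      (by
        simp only [Set.ofPred_and, Set.ofPred_or]
        repeat' first | apply IsOpen.inter | apply IsOpen.union | apply isOpen_lt
        all_goals fun_prop)
      (fun z hz => ⟨hz.1.le, hz.2.1.le, hz.2.2.1.le, hz.2.2.2.1.le, hz.2.2.2.2.1.le,
        hz.2.2.2.2.2.imp le_of_lt le_of_lt⟩) hz
    simp only [Set.mem_ofPred_eq, not_and_or, not_or, not_lt] at hn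
    rcases hn with hn | hn | hn | hn | hn | ⟨hn, hn'⟩
    · have h7 : 0 ≤ hexY (B 0) d z := by rcases h6 with h6 | h6 <;> linarith
      refine Or.inl (Or.inl (hB.mem_chain (o := B 0) (by omega : 1 < N) (by omega) isHexDir_one
        (hexY (B 0) d z) ?_ ?_ ?_ ?_)) <;> linarith
    · refine Or.inl (Or.inl (hB.mem_chain (o := B 0) (by omega : 2 < N) (by omega) isHexDir_two
        (hexY (B 0) d z - ℓ 1) ?_ ?_ ?_ ?_)) <;> linarith
    · refine Or.inl (Or.inl (hB.mem_chain (o := B 0) (by omega : 3 < N) (by omega) isHexDir_three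
        (ℓ 0 - ℓ 2 - hexX (B 0) d z) ?_ ?_ ?_ ?_)) <;> linarith
    · refine Or.inl (Or.inl (hB.mem_chain (o := B 0) (by omega : 4 < N) (by omega) isHexDir_four
        (ℓ 1 + ℓ 2 - hexY (B 0) d z) ?_ ?_ ?_ ?_)) <;> linarith
    · have h7 : hexX (B 0) d z ≤ hexY (B 0) d z := by rcases h6 with h6 | h6 <;> linarith
      refine Or.inl (Or.inr (mem_segment_hex (o := B 0) hB.ne_zero
        (hexX (B 0) d z - (ℓ 0 - ℓ 2 - ℓ 3)) h 1 (-1) ?_ ?_ ?_ ?_ ?_ ?_)) <;> linarith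
    · rcases h6 with h6 | h6
      · refine Or.inl (Or.inl (hB.mem_chain (o := B 0) (by omega : 0 < N) (by omega)
          isHexDir_zero (hexX (B 0) d z) ?_ ?_ ?_ ?_)) <;> linarith
      · rw [segment_symm ℝ H]
        refine Or.inr (mem_segment_hex (o := B 0) hB.ne_zero
          (-hexX (B 0) d z) (-(ℓ 0 - ℓ 2 - ℓ 3 + h)) (-1) (-1) ?_ ?_ ?_ ?_ ?_ ?_) <;> linarith
  · simp only [Set.ofPred_and]
    repeat' first | apply IsOpen.inter | apply isOpen_lt
    all_goals fun_prop
  · refine ⟨?_, ?_, ?_, ?_, ?_⟩ <;> linarith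
  · rintro z ⟨h1, h2, h3, h4, h5⟩ h6
    refine ⟨?_, ?_, ?_, ?_, ?_, Or.inr ?_⟩ <;> linarith
  · rintro z ⟨h1, h2, h3, h4, h5, h6⟩
    linarith

/-! ### Chains that turn inwards within six edges -/

/-- The condition `hside` says that `B 0` lies on or to the left of the line of edge 5. If edge 4
reached the line `Y = 0`, `hside` would put the meeting point on edge 0. -/
theorem lt_of_inward (hB : IsHexChain B d ℓ N) (hs : IsSimpleChain B 0 N) (hN : 4 < N)
    (hside : ℓ 3 + ℓ 4 ≤ ℓ 0 + ℓ 1) : ℓ 4 < ℓ 1 + ℓ 2 := by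
  obtain ⟨x4, y4⟩ := hB.coord_four (by omega)
  have x0 := hexX_self (B 0) d
  have y0 := hexY_self (B 0) d
  have p1 := hB.pos 1 (by omega)
  have p2 := hB.pos 2 (by omega)
  have p3 := hB.pos 3 (by omega)
  by_contra! hle
  refine hB.coord_ne (o := B 0) hs (by omega : 0 + 1 < 4) hN isHexDir_zero isHexDir_four
    (ℓ 0 - ℓ 2 - ℓ 3) (ℓ 1 + ℓ 2) ?_ ?_ ?_ ?_ ?_ ?_ <;> linarith

/-- If the ray of the sixth edge passes `B 0` on the right, the chain stays on the right of its
first six edges. -/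
theorem right_of_inward (hB : IsHexChain B d ℓ N) (hs : IsSimpleChain B 0 N) (hN : 5 < N)
    (hside : ℓ 3 + ℓ 4 ≤ ℓ 0 + ℓ 1) {k : ℕ} (hk : 6 ≤ k) (hkN : k ≤ N) :
    B k ∈ {z | 0 ≤ hexY (B 0) d z ∧ hexX (B 0) d z ≤ ℓ 0 ∧
      hexX (B 0) d z + hexY (B 0) d z ≤ ℓ 0 + ℓ 1 ∧ hexY (B 0) d z ≤ ℓ 1 + ℓ 2 ∧
      ℓ 0 - ℓ 2 - ℓ 3 ≤ hexX (B 0) d z ∧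
      ℓ 0 + ℓ 1 - ℓ 3 - ℓ 4 ≤ hexX (B 0) d z + hexY (B 0) d z} := by
  obtain ⟨x1, y1⟩ := hB.coord_one (by omega)
  obtain ⟨x2, y2⟩ := hB.coord_two (by omega)
  obtain ⟨x3, y3⟩ := hB.coord_three (by omega)
  obtain ⟨x4, y4⟩ := hB.coord_four (by omega)
  obtain ⟨x5, y5⟩ := hB.coord_five (by omega)
  obtain ⟨x6, y6⟩ := hB.coord_six (by omega)
  have x0 := hexX_self (B 0) d
  have y0 := hexY_self (B 0) d
  have p0 := hB.pos 0 (by omega)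
  have p1 := hB.pos 1 (by omega)
  have p2 := hB.pos 2 (by omega)
  have p3 := hB.pos 3 (by omega)
  have p4 := hB.pos 4 (by omega)
  have p5 := hB.pos 5 (by omega)
  have hlt := hB.lt_of_inward hs (by omega) hside
  have hsix : 0 < hexY (B 0) d (B 6) ∧ hexX (B 0) d (B 6) < ℓ 0 := by
    rw [x6, y6]
    -- The ray of edge 5 leaves the region through edge 1 in the first case and through edge 0 in
    -- the second. By simplicity edge 5 ends before that point, so no barrier is needed.
    rcases le_or_gt (ℓ 3 + ℓ 4) (ℓ 1) with hc | hc
    · have : ℓ 5 < ℓ 2 + ℓ 3 := by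
        by_contra! hle
        refine hB.coord_ne (o := B 0) hs (by omega : 1 + 1 < 5) hN isHexDir_one isHexDir_five
          (ℓ 1 - ℓ 3 - ℓ 4) (ℓ 2 + ℓ 3) ?_ ?_ ?_ ?_ ?_ ?_ <;> linarith
      constructor <;> linarith
    · have : ℓ 5 < ℓ 1 + ℓ 2 - ℓ 4 := by
        by_contra! hle
        refine hB.coord_ne (o := B 0) hs (by omega : 0 + 1 < 5) hN isHexDir_zero isHexDir_five
          (ℓ 0 + ℓ 1 - ℓ 3 - ℓ 4) (ℓ 1 + ℓ 2 - ℓ 4) ?_ ?_ ?_ ?_ ?_ ?_ <;> linarith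
      constructor <;> linarith
  set R : Set ℂ := {z | 0 ≤ hexY (B 0) d z ∧ hexX (B 0) d z ≤ ℓ 0 ∧
      hexX (B 0) d z + hexY (B 0) d z ≤ ℓ 0 + ℓ 1 ∧ hexY (B 0) d z ≤ ℓ 1 + ℓ 2 ∧
      ℓ 0 - ℓ 2 - ℓ 3 ≤ hexX (B 0) d z ∧
      ℓ 0 + ℓ 1 - ℓ 3 - ℓ 4 ≤ hexX (B 0) d z + hexY (B 0) d z} with hR
  have hRc : IsClosed R := by
    simp only [hR, Set.ofPred_and]
    repeat' first | apply IsClosed.inter | apply isClosed_le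
    all_goals fun_prop
  have htrap : IsTrap B d ∅ R 5 := by
    refine hB.isTrap (o := B 0) hN isHexDir_five hRc {z | 0 < hexY (B 0) d z ∧
      hexX (B 0) d z < ℓ 0 ∧
      hexX (B 0) d z + hexY (B 0) d z < ℓ 0 + ℓ 1 ∧ hexY (B 0) d z < ℓ 1 + ℓ 2 ∧
      ℓ 0 - ℓ 2 - ℓ 3 < hexX (B 0) d z} ?_ ?_ ?_ ?_ ?_
    · simp only [Set.ofPred_and]
      repeat' first | apply IsOpen.inter | apply isOpen_lt
      all_goals fun_prop
    · refine ⟨hsix.1, hsix.2, ?_, ?_, ?_⟩ <;> linarith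
    · rintro z ⟨h1, h2, h3, h4, h5⟩ h6
      refine ⟨?_, ?_, ?_, ?_, ?_, ?_⟩ <;> linarith
    · rintro z ⟨h1, h2, h3, h4, h5, h6⟩
      linarith
    · intro z hz
      obtain ⟨⟨h1, h2, h3, h4, h5, h6⟩, hn⟩ := mem_of_mem_frontier hRc
        (U := {z | 0 < hexY (B 0) d z ∧ hexX (B 0) d z < ℓ 0 ∧
          hexX (B 0) d z + hexY (B 0) d z < ℓ 0 + ℓ 1 ∧ hexY (B 0) d z < ℓ 1 + ℓ 2 ∧
          ℓ 0 - ℓ 2 - ℓ 3 < hexX (B 0) d z ∧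
          ℓ 0 + ℓ 1 - ℓ 3 - ℓ 4 < hexX (B 0) d z + hexY (B 0) d z})
        (by
          simp only [Set.ofPred_and]
          repeat' first | apply IsOpen.inter | apply isOpen_lt
          all_goals fun_prop)
        (fun z hz => ⟨hz.1.le, hz.2.1.le, hz.2.2.1.le, hz.2.2.2.1.le, hz.2.2.2.2.1.le,
          hz.2.2.2.2.2.le⟩) hz
      simp only [Set.mem_ofPred_eq, not_and_or, not_lt] at hn
      rcases hn with hn | hn | hn | hn | hn | hn
      · refine Or.inl (Or.inl (hB.mem_chain (o := B 0) (by omega : 0 < N) (by omega)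
          isHexDir_zero (hexX (B 0) d z) ?_ ?_ ?_ ?_)) <;> linarith
      · refine Or.inl (Or.inl (hB.mem_chain (o := B 0) (by omega : 1 < N) (by omega) isHexDir_one
          (hexY (B 0) d z) ?_ ?_ ?_ ?_)) <;> linarith
      · refine Or.inl (Or.inl (hB.mem_chain (o := B 0) (by omega : 2 < N) (by omega) isHexDir_two
          (hexY (B 0) d z - ℓ 1) ?_ ?_ ?_ ?_)) <;> linarith
      · refine Or.inl (Or.inl (hB.mem_chain (o := B 0) (by omega : 3 < N) (by omega)
          isHexDir_three (ℓ 0 - ℓ 2 - hexX (B 0) d z) ?_ ?_ ?_ ?_)) <;> linarith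
      · refine Or.inl (Or.inl (hB.mem_chain (o := B 0) (by omega : 4 < N) (by omega)
          isHexDir_four (ℓ 1 + ℓ 2 - hexY (B 0) d z) ?_ ?_ ?_ ?_)) <;> linarith
      · have hz5 : z = B 5 + (hexX (B 0) d z - (ℓ 0 - ℓ 2 - ℓ 3) : ℝ) * (d * hexRot ^ 5) := by
          rw [isHexDir_five]
          refine hex_ext (o := B 0) hB.ne_zero ?_ ?_
          · rw [hexX_add hB.ne_zero]; linarith
          · rw [hexY_add hB.ne_zero]; linarith
        rw [hz5]
        exact hB.mem_ray hN (by linarith) _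
  exact htrap.mem_of_le hB hs (fun _ _ _ z _ => Set.notMem_empty z) (by omega) hkN

/-- The chain is already confined by `right_of_inward`. It remains to enlarge the confining region
to a set `K` whose frontier follows the perpendicular from `B 0` and the ray only up to `H`;
clipping to the first four half-planes also covers an `H` beyond edge 1. -/
theorem mem_enclosedRegion_five_of_ge (hB : IsHexChain B d ℓ N) (hs : IsSimpleChain B 0 N)
    (hN : 5 < N) {H : ℂ} {h : ℝ} (hh : 0 ≤ h) (hH : H = B 5 + h * (d * hexRot ^ 5))
    (hperp : inner ℝ (B 0 - H) (d * hexRot ^ 5) = 0) (hside : ℓ 3 + ℓ 4 ≤ ℓ 0 + ℓ 1) :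
    B N ∈ enclosedRegion (chainCurve B 0 5 ∪ segment ℝ (B 5) H ∪ segment ℝ H (B 0)) := by
  obtain ⟨g1, g2, g3, g4, g5, g6⟩ := hB.right_of_inward hs hN hside (by omega) le_rfl
  obtain ⟨x1, y1⟩ := hB.coord_one (by omega)
  obtain ⟨x2, y2⟩ := hB.coord_two (by omega)
  obtain ⟨x3, y3⟩ := hB.coord_three (by omega)
  obtain ⟨x4, y4⟩ := hB.coord_four (by omega)
  obtain ⟨x5, y5⟩ := hB.coord_five (by omega)
  obtain ⟨xH, yH⟩ := hB.coord_foot isHexDir_five hH (B 0)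
  have hp := hB.perp_coord isHexDir_five hperp
  have x0 := hexX_self (B 0) d
  have y0 := hexY_self (B 0) d
  have p0 := hB.pos 0 (by omega)
  have p1 := hB.pos 1 (by omega)
  have p2 := hB.pos 2 (by omega)
  have p3 := hB.pos 3 (by omega)
  have p4 := hB.pos 4 (by omega)
  have hlt := hB.lt_of_inward hs (by omega) hside
  rw [x5] at xH
  rw [y5] at yH
  rw [xH, yH] at hp
  set K : Set ℂ := {z | 0 ≤ hexY (B 0) d z ∧ hexX (B 0) d z ≤ ℓ 0 ∧
    hexX (B 0) d z + hexY (B 0) d z ≤ ℓ 0 + ℓ 1 ∧ hexY (B 0) d z ≤ ℓ 1 + ℓ 2 ∧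
    (ℓ 0 - ℓ 2 - ℓ 3 ≤ hexX (B 0) d z ∧
      ℓ 0 + ℓ 1 - ℓ 3 - ℓ 4 ≤ hexX (B 0) d z + hexY (B 0) d z ∨
      hexY (B 0) d z ≤ hexX (B 0) d z)} with hK
  have hKc : IsClosed K := by
    simp only [hK, Set.ofPred_and, Set.ofPred_or]
    repeat' first | apply IsClosed.inter | apply IsClosed.union | apply isClosed_le
    all_goals fun_prop
  refine subset_enclosedRegion (K := K) ?_ hKc ?_ ⟨g1, g2, g3, g4, Or.inl ⟨g5, g6⟩⟩
  · refine isBounded_of_hex (o := B 0) hB.ne_zero (ℓ 0 + ℓ 1 + ℓ 2 + ℓ 3 + ℓ 4) ?_ ?_ <;>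
      rintro z ⟨h1, h2, h3, h4, ⟨h5, -⟩ | h5⟩ <;> rw [abs_le] <;> constructor <;> linarith
  · intro z hz
    obtain ⟨⟨h1, h2, h3, h4, h6⟩, hn⟩ := mem_of_mem_frontier hKc
      (U := {z | 0 < hexY (B 0) d z ∧ hexX (B 0) d z < ℓ 0 ∧
        hexX (B 0) d z + hexY (B 0) d z < ℓ 0 + ℓ 1 ∧ hexY (B 0) d z < ℓ 1 + ℓ 2 ∧
        (ℓ 0 - ℓ 2 - ℓ 3 < hexX (B 0) d z ∧
          ℓ 0 + ℓ 1 - ℓ 3 - ℓ 4 < hexX (B 0) d z + hexY (B 0) d z ∨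
          hexY (B 0) d z < hexX (B 0) d z)})
      (by
        simp only [Set.ofPred_and, Set.ofPred_or]
        repeat' first | apply IsOpen.inter | apply IsOpen.union | apply isOpen_lt
        all_goals fun_prop)
      (fun z hz => ⟨hz.1.le, hz.2.1.le, hz.2.2.1.le, hz.2.2.2.1.le,
        hz.2.2.2.2.imp (And.imp le_of_lt le_of_lt) le_of_lt⟩) hz
    simp only [Set.mem_ofPred_eq, not_and_or, not_or, not_lt] at hn
    rcases hn with hn | hn | hn | hn | ⟨hn, hn'⟩
    · have h7 : 0 ≤ hexX (B 0) d z := by rcases h6 with ⟨h5, h6⟩ | h6 <;> linarith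
      refine Or.inl (Or.inl (hB.mem_chain (o := B 0) (by omega : 0 < N) (by omega) isHexDir_zero
        (hexX (B 0) d z) ?_ ?_ ?_ ?_)) <;> linarith
    · refine Or.inl (Or.inl (hB.mem_chain (o := B 0) (by omega : 1 < N) (by omega) isHexDir_one
        (hexY (B 0) d z) ?_ ?_ ?_ ?_)) <;> linarith
    · refine Or.inl (Or.inl (hB.mem_chain (o := B 0) (by omega : 2 < N) (by omega) isHexDir_two
        (hexY (B 0) d z - ℓ 1) ?_ ?_ ?_ ?_)) <;> linarith
    · have h7 : ℓ 0 - ℓ 2 - ℓ 3 ≤ hexX (B 0) d z := by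
        rcases h6 with ⟨h5, h6⟩ | h6 <;> linarith
      refine Or.inl (Or.inl (hB.mem_chain (o := B 0) (by omega : 3 < N) (by omega) isHexDir_three
        (ℓ 0 - ℓ 2 - hexX (B 0) d z) ?_ ?_ ?_ ?_)) <;> linarith
    · rcases h6 with ⟨h5, h6⟩ | h6
      · rcases hn with hn | hn
        · refine Or.inl (Or.inl (hB.mem_chain (o := B 0) (by omega : 4 < N) (by omega)
            isHexDir_four (ℓ 1 + ℓ 2 - hexY (B 0) d z) ?_ ?_ ?_ ?_)) <;> linarith
        · refine Or.inl (Or.inr (mem_segment_hex (o := B 0) hB.ne_zero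
            (hexX (B 0) d z - (ℓ 0 - ℓ 2 - ℓ 3)) h 1 (-1) ?_ ?_ ?_ ?_ ?_ ?_)) <;> linarith
      · have h7 : hexX (B 0) d z ≤ ℓ 0 - ℓ 2 - ℓ 3 + h := by
          rcases hn with hn | hn <;> linarith
        rw [segment_symm ℝ H]
        refine Or.inr (mem_segment_hex (o := B 0) hB.ne_zero
          (hexX (B 0) d z) (ℓ 0 - ℓ 2 - ℓ 3 + h) 1 1 ?_ ?_ ?_ ?_ ?_ ?_) <;> linarith

/-! ### The polygon closed by a chord -/

/-- If the ray of the sixth edge passes `B 0` on the right, the chain stays in the region enclosed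
by its first five edges and the chord from `B 5` to `B 0`. -/
theorem mem_enclosedRegion_chord (hB : IsHexChain B d ℓ N) (hs : IsSimpleChain B 0 N) (hN : 5 < N)
    (hside : ℓ 3 + ℓ 4 ≤ ℓ 0 + ℓ 1) {k : ℕ} (hk : 6 ≤ k) (hkN : k ≤ N) :
    B k ∈ enclosedRegion (chainCurve B 0 5 ∪ segment ℝ (B 5) (B 0)) := by
  obtain ⟨g1, g2, g3, g4, g5, g6⟩ := hB.right_of_inward hs hN hside hk hkN
  obtain ⟨x1, y1⟩ := hB.coord_one (by omega)
  obtain ⟨x2, y2⟩ := hB.coord_two (by omega)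
  obtain ⟨x3, y3⟩ := hB.coord_three (by omega)
  obtain ⟨x4, y4⟩ := hB.coord_four (by omega)
  obtain ⟨x5, y5⟩ := hB.coord_five (by omega)
  have x0 := hexX_self (B 0) d
  have y0 := hexY_self (B 0) d
  have p0 := hB.pos 0 (by omega)
  have p1 := hB.pos 1 (by omega)
  have p2 := hB.pos 2 (by omega)
  have p3 := hB.pos 3 (by omega)
  have p4 := hB.pos 4 (by omega)
  have hlt := hB.lt_of_inward hs (by omega) hside
  -- The coordinates of `B 5` are `a` and `b`; kept opaque, they leave few products for the linear
  -- arithmetic. The chord lies on `b X = a Y`.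
  obtain ⟨a, ha⟩ : ∃ a, a = ℓ 0 - ℓ 2 - ℓ 3 := ⟨_, rfl⟩
  obtain ⟨b, hb⟩ : ∃ b, b = ℓ 1 + ℓ 2 - ℓ 4 := ⟨_, rfl⟩
  have hb0 : 0 < b := by linarith
  have hab : 0 ≤ a + b := by linarith
  rw [← ha] at x5 g5
  rw [← hb] at y5
  have hchord : ∀ z, 0 ≤ hexY (B 0) d z → hexY (B 0) d z ≤ b →
      b * hexX (B 0) d z = a * hexY (B 0) d z → z ∈ segment ℝ (B 5) (B 0) := by
    intro z h1 h2 h3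
    rw [segment_symm]
    refine mem_segment_hex (o := B 0) hB.ne_zero (hexY (B 0) d z) b (a / b) 1 h1 h2 ?_ ?_ ?_ ?_
    · rw [x0]; field_simp; linarith
    · linarith
    · rw [x0, x5]; field_simp; ring
    · linarith
  -- The sign of `a` decides whether the polygon turns right at `B 5`, and `K` is an intersection of
  -- half-planes, or not, and the conditions of edge 4 and the chord are joined by a disjunction.
  rcases lt_or_ge a 0 with ha0 | ha0
  · set K : Set ℂ := {z | 0 ≤ hexY (B 0) d z ∧ hexX (B 0) d z ≤ ℓ 0 ∧
      hexX (B 0) d z + hexY (B 0) d z ≤ ℓ 0 + ℓ 1 ∧ hexY (B 0) d z ≤ ℓ 1 + ℓ 2 ∧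
      a ≤ hexX (B 0) d z ∧ a * hexY (B 0) d z ≤ b * hexX (B 0) d z} with hK
    have hKc : IsClosed K := by
      simp only [hK, Set.ofPred_and]
      repeat' first | apply IsClosed.inter | apply isClosed_le
      all_goals fun_prop
    -- The chord condition is a combination of those of edges 4 and 5: `b X - a Y = (-a) (X + Y - (a
    -- + b)) + (a + b) (X - a)`, with nonnegative coefficients.
    have g7 : a * hexY (B 0) d (B k) ≤ b * hexX (B 0) d (B k) := by
      have e1 := mul_nonneg (by linarith : 0 ≤ -a)
        (by linarith : 0 ≤ hexX (B 0) d (B k) + hexY (B 0) d (B k) - (a + b))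
      have e2 := mul_nonneg hab (by linarith : 0 ≤ hexX (B 0) d (B k) - a)
      linarith
    refine subset_enclosedRegion (K := K) ?_ hKc ?_ ⟨g1, g2, g3, g4, g5, g7⟩
    · refine isBounded_of_hex (o := B 0) hB.ne_zero (ℓ 0 + ℓ 1 + ℓ 2 + ℓ 3) ?_ ?_ <;>
        rintro z ⟨h1, h2, h3, h4, h5, -⟩ <;> rw [abs_le] <;> constructor <;> linarith
    · intro z hz
      obtain ⟨⟨h1, h2, h3, h4, h5, h6⟩, hn⟩ := mem_of_mem_frontier hKc
        (U := {z | 0 < hexY (B 0) d z ∧ hexX (B 0) d z < ℓ 0 ∧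
          hexX (B 0) d z + hexY (B 0) d z < ℓ 0 + ℓ 1 ∧ hexY (B 0) d z < ℓ 1 + ℓ 2 ∧
          a < hexX (B 0) d z ∧ a * hexY (B 0) d z < b * hexX (B 0) d z})
        (by
          simp only [Set.ofPred_and]
          repeat' first | apply IsOpen.inter | apply isOpen_lt
          all_goals fun_prop)
        (fun z hz => ⟨hz.1.le, hz.2.1.le, hz.2.2.1.le, hz.2.2.2.1.le, hz.2.2.2.2.1.le,
          hz.2.2.2.2.2.le⟩) hz
      simp only [Set.mem_ofPred_eq, not_and_or, not_lt] at hn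
      rcases hn with hn | hn | hn | hn | hn | hn
      · have h7 : 0 ≤ hexX (B 0) d z := by
          rw [le_antisymm hn h1, mul_zero] at h6
          exact nonneg_of_mul_nonneg_right h6 hb0
        refine Or.inl (hB.mem_chain (o := B 0) (by omega : 0 < N) (by omega) isHexDir_zero
          (hexX (B 0) d z) ?_ ?_ ?_ ?_) <;> linarith
      · refine Or.inl (hB.mem_chain (o := B 0) (by omega : 1 < N) (by omega) isHexDir_one
          (hexY (B 0) d z) ?_ ?_ ?_ ?_) <;> linarith
      · refine Or.inl (hB.mem_chain (o := B 0) (by omega : 2 < N) (by omega) isHexDir_two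
          (hexY (B 0) d z - ℓ 1) ?_ ?_ ?_ ?_) <;> linarith
      · refine Or.inl (hB.mem_chain (o := B 0) (by omega : 3 < N) (by omega) isHexDir_three
          (ℓ 0 - ℓ 2 - hexX (B 0) d z) ?_ ?_ ?_ ?_) <;> linarith
      · have h7 : b ≤ hexY (B 0) d z := by
          rw [le_antisymm hn h5, mul_comm b] at h6
          exact (mul_le_mul_left_of_neg ha0).mp h6
        refine Or.inl (hB.mem_chain (o := B 0) (by omega : 4 < N) (by omega) isHexDir_four
          (ℓ 1 + ℓ 2 - hexY (B 0) d z) ?_ ?_ ?_ ?_) <;> linarith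
      · refine Or.inr (hchord z h1 ?_ (le_antisymm hn h6))
        by_contra! hcon
        have e1 := mul_lt_mul_of_neg_left hcon ha0
        have e2 := mul_le_mul_of_nonneg_left h5 hb0.le
        linarith
  · set K : Set ℂ := {z | 0 ≤ hexY (B 0) d z ∧ hexX (B 0) d z ≤ ℓ 0 ∧
      hexX (B 0) d z + hexY (B 0) d z ≤ ℓ 0 + ℓ 1 ∧ hexY (B 0) d z ≤ ℓ 1 + ℓ 2 ∧
      (a ≤ hexX (B 0) d z ∨ a * hexY (B 0) d z ≤ b * hexX (B 0) d z)} with hK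
    have hKc : IsClosed K := by
      simp only [hK, Set.ofPred_and, Set.ofPred_or]
      repeat' first | apply IsClosed.inter | apply IsClosed.union | apply isClosed_le
      all_goals fun_prop
    have hX : ∀ z, 0 ≤ hexY (B 0) d z →
        (a ≤ hexX (B 0) d z ∨ a * hexY (B 0) d z ≤ b * hexX (B 0) d z) →
        0 ≤ hexX (B 0) d z := by
      rintro z h1 (h | h)
      · linarith
      · exact nonneg_of_mul_nonneg_right ((mul_nonneg ha0 h1).trans h) hb0
    refine subset_enclosedRegion (K := K) ?_ hKc ?_ ⟨g1, g2, g3, g4, Or.inl g5⟩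
    · refine isBounded_of_hex (o := B 0) hB.ne_zero (ℓ 0 + ℓ 1 + ℓ 2 + ℓ 3) ?_ ?_ <;>
        rintro z ⟨h1, h2, h3, h4, h5⟩ <;> have h6 := hX z h1 h5 <;> rw [abs_le] <;>
        constructor <;> linarith
    · intro z hz
      obtain ⟨⟨h1, h2, h3, h4, h5⟩, hn⟩ := mem_of_mem_frontier hKc
        (U := {z | 0 < hexY (B 0) d z ∧ hexX (B 0) d z < ℓ 0 ∧
          hexX (B 0) d z + hexY (B 0) d z < ℓ 0 + ℓ 1 ∧ hexY (B 0) d z < ℓ 1 + ℓ 2 ∧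
          (a < hexX (B 0) d z ∨ a * hexY (B 0) d z < b * hexX (B 0) d z)})
        (by
          simp only [Set.ofPred_and, Set.ofPred_or]
          repeat' first | apply IsOpen.inter | apply IsOpen.union | apply isOpen_lt
          all_goals fun_prop)
        (fun z hz => ⟨hz.1.le, hz.2.1.le, hz.2.2.1.le, hz.2.2.2.1.le,
          hz.2.2.2.2.imp le_of_lt le_of_lt⟩) hz
      have h6 := hX z h1 h5
      simp only [Set.mem_ofPred_eq, not_and_or, not_or, not_lt] at hn
      rcases hn with hn | hn | hn | hn | ⟨hn, hn'⟩
      · refine Or.inl (hB.mem_chain (o := B 0) (by omega : 0 < N) (by omega) isHexDir_zero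
          (hexX (B 0) d z) ?_ ?_ ?_ ?_) <;> linarith
      · refine Or.inl (hB.mem_chain (o := B 0) (by omega : 1 < N) (by omega) isHexDir_one
          (hexY (B 0) d z) ?_ ?_ ?_ ?_) <;> linarith
      · refine Or.inl (hB.mem_chain (o := B 0) (by omega : 2 < N) (by omega) isHexDir_two
          (hexY (B 0) d z - ℓ 1) ?_ ?_ ?_ ?_) <;> linarith
      · have h7 : a ≤ hexX (B 0) d z := by
          rcases h5 with h5 | h5
          · exact h5
          by_contra! hcon
          have e1 := mul_lt_mul_of_pos_left hcon hb0
          have e2 := mul_le_mul_of_nonneg_left (by linarith : b ≤ hexY (B 0) d z) ha0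
          linarith
        refine Or.inl (hB.mem_chain (o := B 0) (by omega : 3 < N) (by omega) isHexDir_three
          (ℓ 0 - ℓ 2 - hexX (B 0) d z) ?_ ?_ ?_ ?_) <;> linarith
      · rcases le_total b (hexY (B 0) d z) with h7 | h7
        · have h8 : a ≤ hexX (B 0) d z := by
            rcases h5 with h5 | h5
            · exact h5
            by_contra! hcon
            have e1 := mul_lt_mul_of_pos_left hcon hb0
            have e2 := mul_le_mul_of_nonneg_left h7 ha0
            linarith
          refine Or.inl (hB.mem_chain (o := B 0) (by omega : 4 < N) (by omega) isHexDir_four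
            (ℓ 1 + ℓ 2 - hexY (B 0) d z) ?_ ?_ ?_ ?_) <;> linarith
        · refine Or.inr (hchord z h1 h7 (le_antisymm hn' ?_))
          rcases h5 with h5 | h5
          · have e1 := mul_le_mul_of_nonneg_left h7 ha0
            have e2 := mul_le_mul_of_nonneg_left h5 hb0.le
            linarith
          · exact h5

end IsHexChain

/-! ### Shifting the index -/

theorem chainCurve_shift (A : ℕ → ℂ) (u a b : ℕ) :
    chainCurve A (u + a) (u + b) = chainCurve (fun k => A (u + k)) a b := by
  ext z
  rw [mem_chainCurve, mem_chainCurve]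
  constructor
  · rintro ⟨i, hi, hib, hz⟩
    obtain ⟨j, rfl⟩ : ∃ j, i = u + j := ⟨i - u, by omega⟩
    exact ⟨j, by omega, by omega, hz⟩
  · rintro ⟨i, hi, hib, hz⟩
    exact ⟨u + i, by omega, by omega, hz⟩

theorem IsSimpleChain.shift {A : ℕ → ℂ} {a u N : ℕ} (h : IsSimpleChain A a (u + N)) (hau : a ≤ u) :
    IsSimpleChain (fun k => A (u + k)) 0 N := by
  refine ⟨fun i _ hi => h.1 (u + i) (by omega) (by omega), fun i j _ hij hj z hz hz' => ?_⟩
  have := h.2 (u + i) (u + j) (by omega) (by omega) (by omega) z hz hz'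
  exact ⟨by omega, this.2⟩

theorem IsRightTurning120.shift {A : ℕ → ℂ} {a u N : ℕ} (h : IsRightTurning120 A a (u + N))
    (hau : a ≤ u) : IsRightTurning120 (fun k => A (u + k)) 0 N :=
  fun i _ hi => h (u + i) (by omega) (by omega)

theorem IsHexChain.of_shift {A : ℕ → ℂ} {a u N : ℕ} (hs : IsSimpleChain A a (u + N))
    (ht : IsRightTurning120 A a (u + N)) (hau : a ≤ u) (hN : 0 < N) :
    ∃ d ℓ, IsHexChain (fun k => A (u + k)) d ℓ N :=
  (ht.shift hau).exists_isHexChain ((hs.shift hau).1 0 le_rfl hN)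

/-! ### Both parts of the theorem -/

theorem IsSteinerSpiralChain.mem_enclosedRegion {V : Finset ℂ} {E : Finset (Sym2 ℂ)} {n : ℕ}
    {A : ℕ → ℂ} (h : IsSteinerSpiralChain V E n A) {u s v : ℕ} (hus : u < s) (hsv : s ≤ v)
    (hv : v < min 6 n) {H : ℂ}
    (hH : H = EuclideanGeometry.orthogonalProjection (line[ℝ, A v, A (v + 1)]) (A u))
    (hray : H ∈ closedRay (A v) (A (v + 1))) (hdist : dist (A u) H < dist (A (s - 1)) (A s)) :
    A n ∈ enclosedRegion (chainCurve A u v ∪ segment ℝ (A v) H ∪ segment ℝ H (A u)) := by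
  have hv6 : v < 6 := hv.trans_le (min_le_left _ _)
  have hvn : v < n := hv.trans_le (min_le_right _ _)
  have hperp : inner ℝ (A u - H) (A (v + 1) - A v) = 0 := by
    have h1 := EuclideanGeometry.vsub_orthogonalProjection_mem_direction_orthogonal
      (line[ℝ, A v, A (v + 1)]) (A u)
    rw [← hH] at h1
    exact Submodule.inner_left_of_mem_orthogonal
      (AffineSubspace.vsub_mem_direction (right_mem_affineSpan_pair ℝ _ _)
        (left_mem_affineSpan_pair ℝ _ _)) h1
  -- The length hypothesis enters only here: it makes the perpendicular a barrier.
  have htouch : ∀ j, v ≤ j → j < n → ∀ z ∈ segment ℝ (A j) (A (j + 1)), z ∉ segment ℝ H (A u) :=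
    fun j hj hjn z hz hz' => (h.le_dist_of_touch hus (by omega) hjn hz hz').not_gt hdist
  clear hH
  obtain ⟨N, rfl⟩ : ∃ N, n = u + N := ⟨n - u, by omega⟩
  obtain ⟨m, rfl⟩ : ∃ m, v = u + m := ⟨v - u, by omega⟩
  have hm : m < N := by omega
  have hs : IsSimpleChain A 0 (u + N) := h.isSimpleChain_of_le le_rfl
  obtain ⟨d, ℓ, hB⟩ := IsHexChain.of_shift hs h.turn (Nat.zero_le u) (by omega)
  have hs' := hs.shift (Nat.zero_le u)
  have hcurve := chainCurve_shift A u 0 m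
  rw [add_zero] at hcurve
  rw [hcurve]
  have hstep : A (u + m + 1) - A (u + m) = ℓ m * (d * hexRot ^ m) := by
    rw [sub_eq_iff_eq_add']
    exact hB.step m hm
  obtain ⟨t, ht, hHt⟩ := hray
  rw [AffineMap.lineMap_apply, vsub_eq_sub, vadd_eq_add, Complex.real_smul, hstep] at hHt
  have hh : 0 ≤ t * ℓ m := mul_nonneg ht (hB.pos m hm).le
  have hH : H = A (u + m) + (t * ℓ m : ℝ) * (d * hexRot ^ m) := by
    rw [hHt]
    push_cast
    ring
  have hperp' : inner ℝ (A u - H) (d * hexRot ^ m) = 0 := by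
    rw [hstep, ← Complex.real_smul, inner_smul_right] at hperp
    exact (mul_eq_zero.mp hperp).resolve_left (hB.pos m hm).ne'
  have hL : ∀ j, m ≤ j → j < N →
      ∀ z ∈ segment ℝ (A (u + j)) (A (u + (j + 1))), z ∉ segment ℝ H (A u) :=
    fun j hj hjN => htouch (u + j) (by omega) (by omega)
  have hm0 : 0 < m := by omega
  have hm5 : m ≤ 5 := by omega
  clear htouch hcurve hstep hHt hperp hdist hus hsv hv hv6 hvn
  interval_cases m
  · exact (hB.foot_one_false hm hh hH hperp').elim
  · exact hB.mem_enclosedRegion_two hs' hm hh hH hperp' hL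
  · exact hB.mem_enclosedRegion_three hs' hm hh hH hperp' hL
  · rcases lt_or_ge (ℓ 0) (ℓ 2 + ℓ 3) with hside | hside
    · exact hB.mem_enclosedRegion_four_of_lt hs' hm hh hH hperp' hL hside
    · exact hB.mem_enclosedRegion_four_of_ge hs' hm hh hH hperp' hL hside
  · rcases lt_or_ge (ℓ 0 + ℓ 1) (ℓ 3 + ℓ 4) with hside | hside
    · exact hB.mem_enclosedRegion_five_of_lt hs' hm hh hH hperp' hL hside
    · exact hB.mem_enclosedRegion_five_of_ge hs' hm hh hH hperp' hside

/-- Coordinates of a point of an edge. -/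
theorem IsHexChain.exists_coord_of_mem_edge {B : ℕ → ℂ} {d : ℂ} {ℓ : ℕ → ℝ} {N : ℕ}
    (hB : IsHexChain B d ℓ N) {k : ℕ} (hk : k < N) {p q : ℝ} (hdir : IsHexDir k p q) {z : ℂ}
    (hz : z ∈ segment ℝ (B k) (B (k + 1))) (o : ℂ) : ∃ s : ℝ, 0 ≤ s ∧ s ≤ ℓ k ∧
      hexX o d z = hexX o d (B k) + s * p ∧ hexY o d z = hexY o d (B k) + s * q := by
  rw [segment_eq_image', hB.step k hk] at hz
  obtain ⟨θ, hθ, rfl⟩ := hz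
  have hpos := hB.pos k hk
  refine ⟨θ * ℓ k, mul_nonneg hθ.1 hpos.le, mul_le_of_le_one_left hpos.le hθ.2, ?_⟩
  have hz : B k + θ • (B k + ℓ k * (d * hexRot ^ k) - B k)
      = B k + (θ * ℓ k : ℝ) * (d * (p + q * hexRot)) := by
    rw [← hdir, add_sub_cancel_left, Complex.real_smul]
    push_cast
    ring
  change hexX o d (B k + θ • (B k + ℓ k * (d * hexRot ^ k) - B k)) = _ ∧
    hexY o d (B k + θ • (B k + ℓ k * (d * hexRot ^ k) - B k)) = _
  rw [hz, hexX_add hB.ne_zero, hexY_add hB.ne_zero]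
  exact ⟨rfl, rfl⟩

/-- If the ray of the sixth edge meets one of the first four edges, it passes `B 0` on the right. -/
theorem IsHexChain.inward_of_ray_meets {B : ℕ → ℂ} {d : ℂ} {ℓ : ℕ → ℝ} {N : ℕ}
    (hB : IsHexChain B d ℓ N) (hN : 5 < N) {k : ℕ} (hk : k < 4) {z : ℂ}
    (hray : z ∈ closedRay (B 5) (B 6)) (hz : z ∈ segment ℝ (B k) (B (k + 1))) :
    ℓ 3 + ℓ 4 ≤ ℓ 0 + ℓ 1 := by
  obtain ⟨x1, y1⟩ := hB.coord_one (by omega)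
  obtain ⟨x2, y2⟩ := hB.coord_two (by omega)
  obtain ⟨x3, y3⟩ := hB.coord_three (by omega)
  obtain ⟨x5, y5⟩ := hB.coord_five (by omega)
  have x0 := hexX_self (B 0) d
  have y0 := hexY_self (B 0) d
  have p0 := hB.pos 0 (by omega)
  have p3 := hB.pos 3 (by omega)
  have p4 := hB.pos 4 (by omega)
  obtain ⟨t, ht, hzt⟩ := hray
  have hzt' : z = B 5 + (t * ℓ 5 : ℝ) * (d * ((1 : ℝ) + (-1 : ℝ) * hexRot)) := by
    rw [hzt, AffineMap.lineMap_apply, vsub_eq_sub, vadd_eq_add, Complex.real_smul,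
      hB.step 5 hN, isHexDir_five]
    push_cast
    ring
  have hr : 0 ≤ t * ℓ 5 := mul_nonneg ht (hB.pos 5 hN).le
  have xz : hexX (B 0) d z = ℓ 0 - ℓ 2 - ℓ 3 + t * ℓ 5 := by
    rw [hzt', hexX_add hB.ne_zero, x5, mul_one]
  have yz : hexY (B 0) d z = ℓ 1 + ℓ 2 - ℓ 4 - t * ℓ 5 := by
    rw [hzt', hexY_add hB.ne_zero, y5]
    ring
  -- The ray lies on `X + Y = ℓ 0 + ℓ 1 - ℓ 3 - ℓ 4`. On edges 0 and 1 the sum `X + Y` is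
  -- nonnegative, which gives the claim; on edges 2 and 3 it is at least `ℓ 0 + ℓ 1 - ℓ 3`, too
  -- large for the ray to meet them.
  interval_cases k
  · obtain ⟨s, hs0, hsl, hx, hy⟩ := hB.exists_coord_of_mem_edge (by omega) isHexDir_zero hz (B 0)
    linarith
  · obtain ⟨s, hs0, hsl, hx, hy⟩ := hB.exists_coord_of_mem_edge (by omega) isHexDir_one hz (B 0)
    linarith
  · obtain ⟨s, hs0, hsl, hx, hy⟩ := hB.exists_coord_of_mem_edge (by omega) isHexDir_two hz (B 0)
    linarith
  · obtain ⟨s, hs0, hsl, hx, hy⟩ :=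
      hB.exists_coord_of_mem_edge (by omega) isHexDir_three hz (B 0)
    linarith

theorem IsSimpleChain.mem_enclosedRegion_of_ray_meets {n : ℕ} {X : ℕ → ℂ} (hn : 7 ≤ n)
    (hs : IsSimpleChain X 1 n) (ht : IsRightTurning120 X 1 n)
    (hmeet : ∃ k : ℕ, 1 ≤ k ∧ k ≤ 4 ∧
      (closedRay (X 6) (X 7) ∩ segment ℝ (X k) (X (k + 1))).Nonempty)
    {k : ℕ} (hk : 7 ≤ k) (hkn : k ≤ n) :
    X k ∈ enclosedRegion (chainCurve X 1 6 ∪ segment ℝ (X 6) (X 1)) := by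
  obtain ⟨N, rfl⟩ : ∃ N, n = 1 + N := ⟨n - 1, by omega⟩
  obtain ⟨d, ℓ, hB⟩ := IsHexChain.of_shift hs ht le_rfl (by omega)
  obtain ⟨i, hi1, hi4, z, hzr, hz⟩ := hmeet
  obtain ⟨i, rfl⟩ : ∃ j, i = 1 + j := ⟨i - 1, by omega⟩
  obtain ⟨k, rfl⟩ : ∃ j, k = 1 + j := ⟨k - 1, by omega⟩
  have hside := hB.inward_of_ray_meets (by omega) (by omega : i < 4) hzr hz
  have hcurve : chainCurve X 1 6 = _ := chainCurve_shift X 1 0 5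
  rw [hcurve]
  exact hB.mem_enclosedRegion_chord (hs.shift le_rfl) (by omega) hside (by omega) (by omega)

theorem mainTheorem5 :
    (∀ (V : Finset ℂ) (E : Finset (Sym2 ℂ)) (n : ℕ) (A : ℕ → ℂ), IsSteinerSpiralChain V E n A →
      ∀ u s v : ℕ, u < s → s ≤ v → v < min 6 n →
      ∀ H : ℂ, H = EuclideanGeometry.orthogonalProjection (line[ℝ, A v, A (v + 1)]) (A u) →
        H ∈ closedRay (A v) (A (v + 1)) →
        dist (A u) H < dist (A (s - 1)) (A s) →
        A n ∈ enclosedRegion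
          (chainCurve A u v ∪ segment ℝ (A v) H ∪ segment ℝ H (A u))) ∧
    (∀ (n : ℕ) (X : ℕ → ℂ), 7 ≤ n → IsSimpleChain X 1 n → IsRightTurning120 X 1 n →
      (∃ k : ℕ, 1 ≤ k ∧ k ≤ 4 ∧ (closedRay (X 6) (X 7) ∩ segment ℝ (X k) (X (k + 1))).Nonempty) →
      ∀ k : ℕ, 7 ≤ k → k ≤ n →
        X k ∈ enclosedRegion (chainCurve X 1 6 ∪ segment ℝ (X 6) (X 1))) := by
  exact ⟨fun V E n A h u s v hus hsv hv H hH hray hdist =>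
      h.mem_enclosedRegion hus hsv hv hH hray hdist,
    fun n X hn hs ht hmeet k hk hkn => hs.mem_enclosedRegion_of_ray_meets hn ht hmeet hk hkn⟩
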